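/- Let $G$ be a connected (finite-dimensional, real) Lie group and let $\mathfrak g = T_eG$ be its Lie algebra, with its usual bracket; each element $Y\in\mathfrak g$ is identified with the right invariant vector field on $G$ whose value at the identity $e$ is $Y$. A smooth vector field $\mathcal X$ on $G$ is called linear if $\mathcal X(gh) = d(R_h)_g\mathcal X(g) + d(L_g)_h\mathcal X(h)$ for all $g,h\in G$ (equivalently, its flow is a one-parameter group of automorphisms of $G$); it induces the derivation $\mathcal D(Y) = -[\mathcal X,Y]$ of $\mathfrak g$, where $[\mathcal X, Y]$ is the bracket of vector fields. Let $\mathcal X_0,\dots,\mathcal X_m$ be linear vector fields with $[\mathcal X_i,\mathcal X_j]=0$ for all $i,j$, and suppose that their derivations are inner: $\mathcal D_j = \operatorname{ad}(X_j)$ with $X_j\in\mathfrak g$, $j=0,\dots,m$ (equivalently, $\mathcal X_j = X_j + dI\,X_j$, where $I(g)=g^{-1}$ and $dI\,X_j$ is the left invariant vector field with value $-X_j$ at $e$). Let $Y_0,\dots,Y_m$ be right invariant vector fields and let $U\subset\mathbb R^m$. Consider the affine system $$\Sigma_A:\quad \frac{dg}{dt} = (\mathcal X_0+Y_0)(g)+\sum_{j=1}^m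 u_j(\mathcal X_j+Y_j)(g)$$ and the right invariant system $$\Sigma_I:\quad \frac{dg}{dt} = (X_0+Y_0)(g)+\sum_{j=1}^m u_j(X_j+Y_j)(g),$$ where the admissible controls $u=(u_1,\dots,u_m)$ are all the piecewise constant functions $\mathbb R\to U$. For either system, the reachable set at time $t>0$ from $g$ is the set of the endpoints at time $t$ of the solutions that start at $g$ at time $0$, for all admissible controls; the reachable set from $g$ is the union of these sets over all $t>0$; and the system is controllable if the reachable set from every $g\in G$ is $G$. Let $\mathcal A_t$ be the reachable set of $\Sigma_A$ at time $t$ from $e$. If $\Sigma_I$ is controllable and $e\in\operatorname{int}(\mathcal A_t)$ for some $t>0$, then $\Sigma_A$ is controllable. -/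

import Mathlib

open scoped Manifold ContDiff Topology

noncomputable section

namespace AffineControl

section Fields

variable {E : Type*} [NormedAddCommGroup E] [NormedSpace ℝ E]
  {H : Type*} [TopologicalSpace H] (I : ModelWithCorners ℝ E H)
  {G : Type*} [TopologicalSpace G] [ChartedSpace H G]

/-- A control `u : ℝ → ℝᵐ` is piecewise constant if on every bounded interval it is locally
constant except at finitely many points. -/
def IsPiecewiseConstant {m : ℕ} (u : ℝ → Fin m → ℝ) : Prop :=
  ∀ a b : ℝ, {t : ℝ | t ∈ Set.Icc a b ∧ ¬ ∀ᶠ s in 𝓝 t, u s = u t}.Finite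

/-- The admissible controls: all piecewise constant functions `u : ℝ → U ⊆ ℝᵐ`. -/
def IsAdmissible {m : ℕ} (U : Set (Fin m → ℝ)) (u : ℝ → Fin m → ℝ) : Prop :=
  IsPiecewiseConstant u ∧ ∀ t, u t ∈ U

/-- `γ` is a solution on `[0, T]` of `dg/dt = F (u t) (g)`: a continuous curve satisfying the
equation at all but finitely many times. For a piecewise constant control this is the
concatenation of integral curves of the vector fields of the constant controls. -/
def IsSolution {m : ℕ} (F : (Fin m → ℝ) → (g : G) → TangentSpace I g) (u : ℝ → Fin m → ℝ)
    (γ : ℝ → G) (T : ℝ) : Prop :=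
  ContinuousOn γ (Set.Icc 0 T) ∧
    ∃ D : Set ℝ, D.Finite ∧ ∀ t ∈ Set.Ioo 0 T \ D,
      HasMFDerivAt 𝓘(ℝ, ℝ) I γ t ((1 : ℝ →L[ℝ] ℝ).smulRight (F (u t) (γ t)))

/-- The set of points reached from `g` at time exactly `T` with admissible controls. -/
def reachableAt {m : ℕ} (U : Set (Fin m → ℝ))
    (F : (Fin m → ℝ) → (g : G) → TangentSpace I g) (T : ℝ) (g : G) : Set G :=
  {h | ∃ u : ℝ → Fin m → ℝ, IsAdmissible U u ∧
    ∃ γ : ℝ → G, IsSolution I F u γ T ∧ γ 0 = g ∧ γ T = h}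

/-- The set of points reached from `g` at some positive time. -/
def reachable {m : ℕ} (U : Set (Fin m → ℝ))
    (F : (Fin m → ℝ) → (g : G) → TangentSpace I g) (g : G) : Set G :=
  ⋃ T : Set.Ioi (0 : ℝ), reachableAt I U F T g

/-- A control system is controllable if every point can be reached from every point. -/
def IsControllable {m : ℕ} (U : Set (Fin m → ℝ))
    (F : (Fin m → ℝ) → (g : G) → TangentSpace I g) : Prop :=
  ∀ g : G, reachable I U F g = Set.univ

variable [Group G]

/-- The right invariant vector field with value `v` at the identity. -/
def rightInvariantField (v : GroupLieAlgebra I G) (g : G) : TangentSpace I g :=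
  mfderiv I I (fun x : G => x * g) (1 : G) v

/-- A linear vector field: a smooth vector field `𝒳` with
`𝒳 (g h) = d(R_h)_g 𝒳 (g) + d(L_g)_h 𝒳 (h)`; equivalently its flow consists of automorphisms. -/
def IsLinearField [IsManifold I ∞ G] (𝒳 : (g : G) → TangentSpace I g) : Prop :=
  ContMDiff I I.tangent ∞ (fun g => (⟨g, 𝒳 g⟩ : TangentBundle I G)) ∧
    ∀ g h : G, 𝒳 (g * h) =
      (mfderiv I I (fun x : G => x * h) g (𝒳 g) : TangentSpace I (g * h)) +
        (mfderiv I I (fun x : G => g * x) h (𝒳 h) : TangentSpace I (g * h))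

/-- The derivation `𝒟 Y = -[𝒳, Y]` of the Lie algebra (identified with the right invariant vector
fields through their values at the identity) is the inner derivation `ad X`. The bracket
`⁅X, Y⁆` is the usual one of the tangent space at the identity; for a linear field `𝒳` the
condition says that `𝒳` is the sum of the right invariant field of `X` and of its image
under inversion, i.e. that the flow of `𝒳` is `g ↦ exp (t X) g exp (-t X)`. -/
def DerivationEqAd (𝒳 : (g : G) → TangentSpace I g) (X : GroupLieAlgebra I G) : Prop :=
  ∀ (Y : GroupLieAlgebra I G) (g : G),
    -VectorField.mlieBracket I 𝒳 (rightInvariantField I Y) g = rightInvariantField I ⁅X, Y⁆ g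

/-- The affine system
`dg/dt = (𝒳₀ + Y₀)(g) + ∑ j, uⱼ (𝒳ⱼ + Yⱼ)(g)`, with right invariant `Yⱼ`. -/
def affineSystem {m : ℕ} (𝒳 : Fin (m + 1) → (g : G) → TangentSpace I g)
    (Y : Fin (m + 1) → GroupLieAlgebra I G) (u : Fin m → ℝ) (g : G) : TangentSpace I g :=
  (𝒳 0 g + rightInvariantField I (Y 0) g) +
    ∑ j : Fin m, u j • (𝒳 j.succ g + rightInvariantField I (Y j.succ) g)

/-- The right invariant system
`dg/dt = (X₀ + Y₀)(g) + ∑ j, uⱼ (Xⱼ + Yⱼ)(g)`. -/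
def invariantSystem {m : ℕ} (X Y : Fin (m + 1) → GroupLieAlgebra I G)
    (u : Fin m → ℝ) (g : G) : TangentSpace I g :=
  (rightInvariantField I (X 0) g + rightInvariantField I (Y 0) g) +
    ∑ j : Fin m, u j •
      (rightInvariantField I (X j.succ) g + rightInvariantField I (Y j.succ) g)

end Fields

end AffineControl

end

/-!
If `X` is the element of the Lie algebra with `𝒟 = ad X`, then the linear field `𝒳` is the difference
of the right invariant and the left invariant fields of value `X` at the identity
(`IsLinearField.fieldValue_eq`): translated to the identity, both are cocycles for the adjoint
representation, and they have the same derivative `ad X` at `1`. Consequently, for each control `u`,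
a trajectory `A` of the invariant system and the solution `B` of `dB/dt = X(u) B` with `B 0 = 1`
give the trajectory `A B⁻¹` of the affine system, and each trajectory `γ` of the affine system gives
the trajectories `γ (B b B⁻¹)`, `b ∈ G`
(`reachable_affineSystem_of_invariantSystem`, `reachable_affineSystem_mul`).

Let `𝓑` be the subgroup generated by the exponentials of the elements `X₀ + ∑ uⱼ Xⱼ`; it contains
the end points of the curves `B`, and it is connected. Since the fields `𝒳ⱼ` commute, so do the
operators `ad Xⱼ`, hence the operators `Ad b` for `b ∈ 𝓑`. Commutators of elements of `𝓑` therefore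
have a trivial adjoint action and are central in `𝓑` (`commute_commutator_of_mem_expSubgroup`).

The rest is group theory (`forall_of_transitive_of_commutator`). Right translations by central
elements of `𝓑` are symmetries of the affine system, and right translations by `𝓑` are symmetries up
to commutators in `𝓑`. A neighbourhood of `1` is reachable from `1`, so by connectedness all
commutators of `𝓑`, and then all elements of `𝓑`, are reachable from `1`; the symmetries show that
conversely `1` is reachable from `𝓑`. Finally, controllability of the invariant system says that
from each `g` one can reach `h β⁻¹` for some `β ∈ 𝓑`: with `h = 1` this leads from `g` into `𝓑`, and
so to `1`; with `g = 1` and a translation by `β` it leads from `𝓑` to `h`.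
-/

/-! ### Transitive relations on topological groups -/

/-- A subset of a topological group that is closed under multiplication and contains, inside a
subgroup `H`, a neighbourhood of the identity of `H`, contains each connected subset of `H` that
passes through the identity. -/
theorem Subgroup.subset_of_isPreconnected_of_nhds_one {G : Type*} [TopologicalSpace G] [Group G]
    [IsTopologicalGroup G] (H : Subgroup G) {P W K : Set G} (hW : W ∈ 𝓝 (1 : G))
    (hWP : ∀ w ∈ W, w ∈ H → w ∈ P) (hP : ∀ x ∈ H, ∀ y ∈ H, x ∈ P → y ∈ P → x * y ∈ P)
    (hK : IsPreconnected K) (hKH : K ⊆ H) (h1 : (1 : G) ∈ K) :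
    K ⊆ P := by
  -- the open subgroup of `H` consisting of the elements that lie in `P` with their inverses
  have hone : (1 : G) ∈ P := hWP 1 (mem_of_mem_nhds hW) H.one_mem
  let S : Subgroup H :=
    { carrier := {x | (x : G) ∈ P ∧ (x : G)⁻¹ ∈ P}
      one_mem' := by simpa using hone
      mul_mem' := by
        rintro x y ⟨hx, hx'⟩ ⟨hy, hy'⟩
        refine ⟨hP x x.2 y y.2 hx hy, ?_⟩
        have := hP _ (H.inv_mem y.2) _ (H.inv_mem x.2) hy' hx'
        simpa using this
      inv_mem' := by
        rintro x ⟨hx, hx'⟩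
        exact ⟨by simpa using hx', by simpa using hx⟩ }
  have hS : (S : Set H) ∈ 𝓝 (1 : H) := by
    have h1 : ∀ᶠ x : H in 𝓝 1, (x : G) ∈ W :=
      (continuous_subtype_val.tendsto' (1 : H) (1 : G) rfl).eventually hW
    have h2 : ∀ᶠ x : H in 𝓝 1, (x : G)⁻¹ ∈ W :=
      (continuous_subtype_val.inv.tendsto' (1 : H) (1 : G) (by simp)).eventually hW
    filter_upwards [h1, h2] with x hx hx'
    exact ⟨hWP _ hx x.2, hWP _ hx' (H.inv_mem x.2)⟩
  have hopen : IsOpen (S : Set H) := S.isOpen_of_mem_nhds hS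
  have hclopen : IsClopen (S : Set H) := ⟨S.isClosed_of_isOpen hopen, hopen⟩
  have hK' : IsPreconnected ((↑) ⁻¹' K : Set H) := by
    rw [← Topology.IsInducing.subtypeVal.isPreconnected_image]
    convert hK using 1
    ext x
    exact ⟨fun ⟨y, hy, hyx⟩ => hyx ▸ hy, fun hx => ⟨⟨x, hKH hx⟩, hx, rfl⟩⟩
  have := hK'.subset_isClopen hclopen ⟨1, h1, S.one_mem⟩
  intro x hx
  exact (this (show (⟨x, hKH hx⟩ : H) ∈ _ from hx)).1

/-- The algebraic core of the argument: a transitive relation `R` on a topological group `G`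
is total as soon as it is locally transitive at `1`, relates everything to everything up to a
subgroup `B` that is connected and nilpotent of class two, and is invariant under right
translations by elements of `B` up to commutators in `B`. -/
theorem forall_of_transitive_of_commutator {G : Type*} [TopologicalSpace G] [Group G]
    [IsTopologicalGroup G] (B : Subgroup G) (R : G → G → Prop)
    (htrans : ∀ {a b c}, R a b → R b c → R a c)
    (hcomm : ∀ x ∈ B, ∀ y ∈ B, ∀ z ∈ B, Commute (x * y * x⁻¹ * y⁻¹) z)
    (hconn : ∀ x ∈ B, ∃ K : Set G, IsPreconnected K ∧ K ⊆ B ∧ 1 ∈ K ∧ x ∈ K)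
    (hshift : ∀ g h, R g h → ∃ β ∈ B, ∀ b, R (g * b) (h * (β * b * β⁻¹)))
    (hloc : ∀ᶠ x in 𝓝 (1 : G), R 1 x)
    (hreach : ∀ g h, ∃ β ∈ B, R g (h * β⁻¹)) (g h : G) : R g h := by
  let Z : Subgroup G := B ⊓ Subgroup.centralizer (B : Set G)
  have hZB : ∀ z ∈ Z, z ∈ B := fun z hz => hz.1
  have hZc : ∀ z ∈ Z, ∀ b ∈ B, b * z = z * b := fun z hz b hb =>
    Subgroup.mem_centralizer_iff.1 hz.2 b hb
  have hcomZ : ∀ x ∈ B, ∀ y ∈ B, x * y * x⁻¹ * y⁻¹ ∈ Z := fun x hx y hy =>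
    ⟨B.mul_mem (B.mul_mem (B.mul_mem hx hy) (B.inv_mem hx)) (B.inv_mem hy),
      Subgroup.mem_centralizer_iff.2 fun z hz => (hcomm x hx y hy z hz).symm⟩
  -- right translations by `Z` are symmetries
  have hsymm : ∀ z ∈ Z, ∀ {g h}, R g h → R (g * z) (h * z) := by
    intro z hz g h hgh
    obtain ⟨β, hβ, H⟩ := hshift g h hgh
    have := H z
    rwa [hZc z hz β hβ, mul_assoc z, mul_inv_cancel, mul_one] at this
  -- commutators are reached from `1`
  have hcomR : ∀ x ∈ B, ∀ y ∈ B, R 1 (x * y * x⁻¹ * y⁻¹) := by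
    intro x hx y hy
    obtain ⟨K, hK, hKB, h1, hxK⟩ := hconn x hx
    have hsub := Z.subset_of_isPreconnected_of_nhds_one (P := {z | R 1 z})
      (K := (fun k => k * y * k⁻¹ * y⁻¹) '' K) hloc (fun w hw _ => hw)
      (fun a _ b hb ha' hb' => htrans hb' (by
        have := hsymm b hb ha'
        rwa [one_mul] at this))
      (hK.image _ (by fun_prop))
      (by rintro _ ⟨k, hk, rfl⟩; exact hcomZ k (hKB hk) y hy) ⟨1, h1, by simp⟩
    exact hsub ⟨x, hxK, rfl⟩
  let Z₀ : Set G := {z | z ∈ Z ∧ R 1 z ∧ R 1 z⁻¹}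
  have hcomZ₀ : ∀ x ∈ B, ∀ y ∈ B, x * y * x⁻¹ * y⁻¹ ∈ Z₀ := fun x hx y hy =>
    ⟨hcomZ x hx y hy, hcomR x hx y hy, by
      have := hcomR y hy x hx
      simpa [mul_assoc] using this⟩
  have hZ₀mul : ∀ z ∈ Z₀, ∀ w ∈ Z₀, z * w ∈ Z₀ := by
    rintro z ⟨hz, hz1, hz2⟩ w ⟨hw, hw1, hw2⟩
    refine ⟨Z.mul_mem hz hw, htrans hw1 ?_, ?_⟩
    · simpa using hsymm w hw hz1
    · rw [mul_inv_rev]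
      refine htrans hz2 ?_
      simpa using hsymm _ (Z.inv_mem hz) hw2
  have hZ₀inv : ∀ z ∈ Z₀, z⁻¹ ∈ Z₀ := fun z hz => ⟨Z.inv_mem hz.1, hz.2.2, by simpa using hz.2.1⟩
  -- right translations by `B` are symmetries up to `Z₀`
  have hshiftB : ∀ {g h}, R g h → ∀ b ∈ B, ∃ z ∈ Z₀, R (g * b) (h * b * z) := by
    intro g h hgh b hb
    obtain ⟨β, hβ, H⟩ := hshift g h hgh
    refine ⟨_, hcomZ₀ β hβ b hb, ?_⟩
    have h1 := hZc _ (hcomZ β hβ b hb) b hb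
    rw [mul_assoc h, h1]
    simpa [mul_assoc] using H b
  have hQ : ∀ b ∈ B, ∃ z ∈ Z₀, R 1 (b * z) := by
    intro x hx
    obtain ⟨K, hK, hKB, h1, hxK⟩ := hconn x hx
    refine B.subset_of_isPreconnected_of_nhds_one (P := {b | ∃ z ∈ Z₀, R 1 (b * z)}) hloc
      (fun w hw hwB => ⟨1, ?_, by simpa using hw⟩) ?_ hK hKB h1 hxK
    · simpa using hcomZ₀ 1 B.one_mem 1 B.one_mem
    · rintro a ha b hb ⟨z, hz, haz⟩ ⟨w, hw, hbw⟩
      obtain ⟨y, hy, hR⟩ := hshiftB haz (b * w) (B.mul_mem hb (hZB _ hw.1))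
      refine ⟨z * w * y, hZ₀mul _ (hZ₀mul _ hz _ hw) _ hy, htrans hbw ?_⟩
      rw [one_mul] at hR
      have : a * z * (b * w) * y = a * b * (z * w * y) := by
        rw [mul_assoc a z, ← mul_assoc z b w, ← hZc z hz.1 b hb]
        simp only [mul_assoc]
      rwa [this] at hR
  have hto : ∀ b ∈ B, R 1 b := by
    intro b hb
    obtain ⟨z, hz, h⟩ := hQ b hb
    refine htrans hz.2.2 ?_
    simpa using hsymm _ (Z.inv_mem hz.1) h
  have hfrom : ∀ b ∈ B, R b 1 := by
    intro b hb
    obtain ⟨z, hz, h⟩ := hshiftB (hto b⁻¹ (B.inv_mem hb)) b hb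
    simp only [one_mul, inv_mul_cancel] at h
    refine htrans h ?_
    simpa using hsymm z hz.1 hz.2.2
  refine htrans (b := 1) ?_ ?_
  · obtain ⟨β, hβ, H⟩ := hreach g 1
    rw [one_mul] at H
    exact htrans H (hfrom _ (B.inv_mem hβ))
  · obtain ⟨β, hβ, H⟩ := hreach 1 h
    obtain ⟨z, hz, H'⟩ := hshiftB H β hβ
    have := hsymm _ (Z.inv_mem hz.1) H'
    simp only [one_mul, inv_mul_cancel_right, mul_inv_cancel_right] at this
    exact htrans (hto _ (B.mul_mem hβ (B.inv_mem (hZB _ hz.1)))) this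

/-! ### Differentials of translations and velocities of curves -/

namespace AffineControl

section Calculus

variable {E : Type*} [NormedAddCommGroup E] [NormedSpace ℝ E]
  {G : Type*} [TopologicalSpace G] [ChartedSpace E G]

/-- The curve `γ` in `G` has velocity `v` at time `t`. -/
def HasVelocity (γ : ℝ → G) (v : E) (t : ℝ) : Prop :=
  HasMFDerivAt 𝓘(ℝ, ℝ) 𝓘(ℝ, E) γ t
    ((1 : ℝ →L[ℝ] ℝ).smulRight (v : TangentSpace 𝓘(ℝ, E) (γ t)))

theorem HasVelocity.continuousAt {γ : ℝ → G} {v : E} {t : ℝ} (h : HasVelocity γ v t) :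
    ContinuousAt γ t :=
  HasMFDerivAt.continuousAt h

theorem HasVelocity.unique {γ : ℝ → G} {v w : E} {t : ℝ} (h : HasVelocity γ v t)
    (h' : HasVelocity γ w t) : v = w := by
  have := DFunLike.congr_fun (hasMFDerivAt_unique h h') (1 : ℝ)
  change (1 : ℝ) • v = (1 : ℝ) • w at this
  simpa using this

theorem hasVelocity_const (g : G) (t : ℝ) : HasVelocity (fun _ => g) (0 : E) t := by
  refine HasMFDerivAt.congr_mfderiv (hasMFDerivAt_const g t) ?_
  ext
  exact (smul_zero (1 : ℝ)).symm

theorem HasMFDerivAt.hasVelocity {γ : ℝ → G} {t : ℝ} {D : ℝ →L[ℝ] E}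
    (h : HasMFDerivAt 𝓘(ℝ, ℝ) 𝓘(ℝ, E) γ t D) : HasVelocity γ (D 1) t := by
  refine HasMFDerivAt.congr_mfderiv h (ContinuousLinearMap.ext_ring ?_)
  exact (one_smul ℝ (_ : E)).symm

variable [Group G]

/-- The differential at `h` of the left translation by `g`. The tangent spaces of `G` are
definitionally equal to the model space `E`, and the differential is recorded as an operator
of `E`, so that base points can be rewritten freely. -/
noncomputable def leftDeriv (g h : G) : E →L[ℝ] E :=
  mfderiv 𝓘(ℝ, E) 𝓘(ℝ, E) (fun x : G => g * x) h

/-- The differential at `g` of the right translation by `k`, as an operator of `E`. -/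
noncomputable def rightDeriv (k g : G) : E →L[ℝ] E :=
  mfderiv 𝓘(ℝ, E) 𝓘(ℝ, E) (fun x : G => x * k) g

/-- The adjoint representation of `G` on its Lie algebra, as operators of `E`: the differential at
the identity of the conjugation by `g`. -/
noncomputable def adjoint (g : G) : E →L[ℝ] E :=
  (rightDeriv g⁻¹ g).comp (leftDeriv g 1)

variable [LieGroup 𝓘(ℝ, E) ∞ G]

theorem hasMFDerivAt_leftDeriv (g h : G) :
    HasMFDerivAt 𝓘(ℝ, E) 𝓘(ℝ, E) (fun x : G => g * x) h (leftDeriv g h : E →L[ℝ] E) :=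
  ((contMDiff_mul_left (I := 𝓘(ℝ, E)) (n := ∞) (a := g)).mdifferentiableAt
    (by simp)).hasMFDerivAt

theorem hasMFDerivAt_rightDeriv (k g : G) :
    HasMFDerivAt 𝓘(ℝ, E) 𝓘(ℝ, E) (fun x : G => x * k) g (rightDeriv k g : E →L[ℝ] E) :=
  ((contMDiff_mul_right (I := 𝓘(ℝ, E)) (n := ∞) (a := k)).mdifferentiableAt
    (by simp)).hasMFDerivAt

theorem leftDeriv_comp (g h k : G) :
    (leftDeriv g (h * k)).comp (leftDeriv h k : E →L[ℝ] E) = leftDeriv (g * h) k := by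
  have := (hasMFDerivAt_leftDeriv (E := E) g (h * k)).comp k (hasMFDerivAt_leftDeriv (E := E) h k)
  have h2 := hasMFDerivAt_leftDeriv (E := E) (g * h) k
  have e : (fun x : G => g * x) ∘ (fun x : G => h * x) = fun x => g * h * x := by
    ext x; simp [mul_assoc]
  rw [e] at this
  exact hasMFDerivAt_unique this h2

theorem rightDeriv_comp (g h k : G) :
    (rightDeriv g (k * h)).comp (rightDeriv h k : E →L[ℝ] E) = rightDeriv (h * g) k := by
  have := (hasMFDerivAt_rightDeriv (E := E) g (k * h)).comp k
    (hasMFDerivAt_rightDeriv (E := E) h k)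
  have h2 := hasMFDerivAt_rightDeriv (E := E) (h * g) k
  have e : (fun x : G => x * g) ∘ (fun x : G => x * h) = fun x => x * (h * g) := by
    ext x; simp [mul_assoc]
  rw [e] at this
  exact hasMFDerivAt_unique this h2

theorem rightDeriv_comp_leftDeriv (g h k : G) :
    (rightDeriv h (g * k)).comp (leftDeriv g k : E →L[ℝ] E) =
      (leftDeriv g (k * h)).comp (rightDeriv h k) := by
  have := (hasMFDerivAt_rightDeriv (E := E) h (g * k)).comp k
    (hasMFDerivAt_leftDeriv (E := E) g k)
  have h2 := (hasMFDerivAt_leftDeriv (E := E) g (k * h)).comp k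
    (hasMFDerivAt_rightDeriv (E := E) h k)
  have e : (fun x : G => x * h) ∘ (fun x : G => g * x) =
      (fun x : G => g * x) ∘ (fun x : G => x * h) := by
    ext x; simp [mul_assoc]
  rw [e] at this
  exact hasMFDerivAt_unique this h2

theorem leftDeriv_one (g : G) : (leftDeriv 1 g : E →L[ℝ] E) = ContinuousLinearMap.id ℝ E := by
  have e : (fun x : G => 1 * x) = id := by ext x; simp
  have h := hasMFDerivAt_leftDeriv (E := E) 1 g
  rw [e] at h
  exact hasMFDerivAt_unique h (hasMFDerivAt_id g)

theorem rightDeriv_one (g : G) : (rightDeriv 1 g : E →L[ℝ] E) = ContinuousLinearMap.id ℝ E := by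
  have e : (fun x : G => x * 1) = id := by ext x; simp
  have h := hasMFDerivAt_rightDeriv (E := E) 1 g
  rw [e] at h
  exact hasMFDerivAt_unique h (hasMFDerivAt_id g)

theorem leftDeriv_leftDeriv (g h k : G) (v : E) :
    leftDeriv g (h * k) (leftDeriv h k v) = leftDeriv (g * h) k v := by
  rw [← leftDeriv_comp]; rfl

theorem rightDeriv_rightDeriv (g h k : G) (v : E) :
    rightDeriv g (k * h) (rightDeriv h k v) = rightDeriv (h * g) k v := by
  rw [← rightDeriv_comp]; rfl

theorem rightDeriv_leftDeriv (g h k : G) (v : E) :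
    rightDeriv h (g * k) (leftDeriv g k v) = leftDeriv g (k * h) (rightDeriv h k v) :=
  DFunLike.congr_fun (rightDeriv_comp_leftDeriv g h k) v

theorem rightDeriv_adjoint (g : G) (v : E) :
    rightDeriv g 1 (adjoint g v) = leftDeriv g 1 v := by
  have := rightDeriv_rightDeriv (E := E) g g⁻¹ g (leftDeriv g 1 v)
  simpa [adjoint, rightDeriv_one] using this

theorem rightDeriv_inv_rightDeriv (g : G) (v : E) :
    rightDeriv g⁻¹ g (rightDeriv g 1 v) = v := by
  have := rightDeriv_rightDeriv (E := E) g⁻¹ g 1 v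
  simpa [rightDeriv_one] using this

theorem rightDeriv_rightDeriv_inv (g : G) (v : E) :
    rightDeriv g 1 (rightDeriv g⁻¹ g v) = v := by
  have := rightDeriv_rightDeriv (E := E) g g⁻¹ g v
  simpa [rightDeriv_one] using this

theorem rightDeriv_injective (g : G) : Function.Injective (rightDeriv g 1 : E →L[ℝ] E) :=
  Function.LeftInverse.injective (rightDeriv_inv_rightDeriv g)

theorem adjoint_one : (adjoint (1 : G) : E →L[ℝ] E) = ContinuousLinearMap.id ℝ E := by
  ext v
  simp [adjoint, rightDeriv_one, leftDeriv_one]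

theorem adjoint_mul_apply (g h : G) (v : E) : adjoint (g * h) v = adjoint g (adjoint h v) := by
  apply rightDeriv_injective (g * h)
  have h1 := rightDeriv_rightDeriv (E := E) h g 1 (adjoint g (adjoint h v))
  rw [one_mul] at h1
  rw [rightDeriv_adjoint, ← h1, rightDeriv_adjoint]
  have h2 := rightDeriv_leftDeriv (E := E) g h 1 (adjoint h v)
  rw [mul_one, one_mul, rightDeriv_adjoint] at h2
  have h3 := leftDeriv_leftDeriv (E := E) g h 1 v
  rw [mul_one] at h3
  rw [h2, h3]

theorem adjoint_inv_adjoint (g : G) (v : E) : adjoint g⁻¹ (adjoint g v) = v := by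
  rw [← adjoint_mul_apply, inv_mul_cancel, adjoint_one]; rfl

theorem HasVelocity.mul {a b : ℝ → G} {v w : E} {t : ℝ} (ha : HasVelocity a v t)
    (hb : HasVelocity b w t) :
    HasVelocity (fun s => a s * b s)
      (rightDeriv (b t) (a t) v + leftDeriv (a t) (b t) w) t := by
  have hm := ((contMDiff_mul 𝓘(ℝ, E) ∞ (G := G)).mdifferentiableAt
    (x := (a t, b t)) (by simp))
  have hp := HasMFDerivAt.prodMk ha hb
  have h := hm.hasMFDerivAt.comp t hp
  refine HasMFDerivAt.congr_mfderiv h ?_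
  ext
  change (mfderiv (𝓘(ℝ, E).prod 𝓘(ℝ, E)) 𝓘(ℝ, E) (fun p : G × G => p.1 * p.2) (a t, b t) :
    E × E →L[ℝ] E) ((1 : ℝ) • v, (1 : ℝ) • w) = (1 : ℝ) • (_ : E)
  rw [one_smul, one_smul, one_smul]
  exact mfderiv_prod_eq_add_apply hm (v := (v, w))

theorem HasVelocity.mul_const {a : ℝ → G} {v : E} {t : ℝ} (ha : HasVelocity a v t) (g : G) :
    HasVelocity (fun s => a s * g) (rightDeriv g (a t) v) t := by
  simpa using ha.mul (hasVelocity_const g t)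

theorem HasVelocity.const_mul {a : ℝ → G} {v : E} {t : ℝ} (ha : HasVelocity a v t) (g : G) :
    HasVelocity (fun s => g * a s) (leftDeriv g (a t) v) t := by
  simpa using (hasVelocity_const g t).mul ha

theorem HasVelocity.inv {a : ℝ → G} {v : E} {t : ℝ} (ha : HasVelocity a v t) :
    HasVelocity (fun s => (a s)⁻¹) (-leftDeriv (a t)⁻¹ 1 (rightDeriv (a t)⁻¹ (a t) v)) t := by
  have hd := ((contMDiff_inv 𝓘(ℝ, E) ∞ (G := G)).mdifferentiableAt
    (x := a t) (by simp)).hasMFDerivAt.comp t ha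
  obtain ⟨w, hw⟩ : ∃ w : E, HasVelocity (fun s => (a s)⁻¹) w t := ⟨_, HasMFDerivAt.hasVelocity hd⟩
  -- differentiate the identity `a s * (a s)⁻¹ = 1`
  have h0 : rightDeriv (a t)⁻¹ (a t) v + leftDeriv (a t) (a t)⁻¹ w = 0 := by
    have h1 := ha.mul hw
    simp only [mul_inv_cancel] at h1
    exact h1.unique (hasVelocity_const 1 t)
  have h2 := leftDeriv_leftDeriv (E := E) (a t)⁻¹ (a t) (a t)⁻¹ w
  rw [mul_inv_cancel, inv_mul_cancel, leftDeriv_one, eq_neg_of_add_eq_zero_right h0, map_neg] at h2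
  rw [h2]
  exact hw

/-- The inverse of an integral curve of a right invariant field is an integral curve of the
opposite of the left invariant field with the same value at the identity. -/
theorem HasVelocity.inv_of_rightInvariant {a : ℝ → G} {v : E} {t : ℝ}
    (ha : HasVelocity a (rightDeriv (a t) 1 v) t) :
    HasVelocity (fun s => (a s)⁻¹) (-leftDeriv (a t)⁻¹ 1 v) t := by
  have := ha.inv
  rwa [rightDeriv_inv_rightDeriv] at this

theorem HasVelocity.inv_of_leftInvariant {a : ℝ → G} {v : E} {t : ℝ}
    (ha : HasVelocity a (leftDeriv (a t) 1 v) t) :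
    HasVelocity (fun s => (a s)⁻¹) (-rightDeriv (a t)⁻¹ 1 v) t := by
  have h := ha.inv
  have h1 := rightDeriv_leftDeriv (E := E) (a t) (a t)⁻¹ 1 v
  have h2 := leftDeriv_leftDeriv (E := E) (a t)⁻¹ (a t) (a t)⁻¹ (rightDeriv (a t)⁻¹ 1 v)
  rw [mul_one, one_mul] at h1
  rw [mul_inv_cancel, inv_mul_cancel, leftDeriv_one] at h2
  rw [h1, h2] at h
  exact h

end Calculus
end AffineControl

/-! ### The bracket as a second derivative of the multiplication -/

namespace AffineControl

section SecondOrder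

variable {E : Type*} [NormedAddCommGroup E] [NormedSpace ℝ E]

/-- The mixed second derivative of `μ : E × E → E` at `(p, p)`, in the direction `X` of the first
variable and `Y` of the second one. -/
noncomputable def mixedDeriv (μ : E × E → E) (p X Y : E) : E :=
  fderiv ℝ (fderiv ℝ μ) (p, p) (X, 0) (0, Y)

theorem hasFDerivAt_fderiv_snd {μ : E × E → E} {p : E} (hμ : ContDiffAt ℝ ∞ μ (p, p)) (Y : E) :
    HasFDerivAt (fun x => fderiv ℝ μ (x, p) (0, Y))
      (((fderiv ℝ (fderiv ℝ μ) (p, p)).flip (0, Y)).comp (ContinuousLinearMap.inl ℝ E E)) p := by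
  have h1 : HasFDerivAt (fderiv ℝ μ) (fderiv ℝ (fderiv ℝ μ) (p, p)) (p, p) :=
    ((hμ.fderiv_right (m := 1) (by norm_cast)).differentiableAt (by simp)).hasFDerivAt
  have h2 := HasFDerivAt.comp (f := fun x => (x, p)) p h1 (hasFDerivAt_prodMk_left p p)
  exact h2.clm_apply (hasFDerivAt_const ((0 : E), Y) p) |>.congr_fderiv (by ext; simp)

theorem hasFDerivAt_fderiv_fst {μ : E × E → E} {p : E} (hμ : ContDiffAt ℝ ∞ μ (p, p)) :
    HasFDerivAt (fun x => (fderiv ℝ μ (p, x)).comp (ContinuousLinearMap.inl ℝ E E))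
      ((ContinuousLinearMap.compL ℝ E (E × E) E).flip (ContinuousLinearMap.inl ℝ E E) ∘L
        (fderiv ℝ (fderiv ℝ μ) (p, p)).comp (ContinuousLinearMap.inr ℝ E E)) p := by
  have h1 : HasFDerivAt (fderiv ℝ μ) (fderiv ℝ (fderiv ℝ μ) (p, p)) (p, p) :=
    ((hμ.fderiv_right (m := 1) (by norm_cast)).differentiableAt (by simp)).hasFDerivAt
  have h2 := HasFDerivAt.comp (f := fun x => (p, x)) p h1 (hasFDerivAt_prodMk_right p p)
  exact ((ContinuousLinearMap.compL ℝ E (E × E) E).flip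
    (ContinuousLinearMap.inl ℝ E E)).hasFDerivAt.comp p h2

theorem fderiv_fderiv_inr_inl {μ : E × E → E} {p : E} (hμ : ContDiffAt ℝ ∞ μ (p, p)) (X Y : E) :
    fderiv ℝ (fderiv ℝ μ) (p, p) (0, X) (Y, 0) = mixedDeriv μ p Y X :=
  hμ.isSymmSndFDerivAt (by
    rw [minSmoothness_of_isRCLikeNormedField]
    exact WithTop.coe_le_coe.2 (le_top : (2 : ℕ∞) ≤ ⊤)) _ _

/-- Differentiation of a function `w` given implicitly by `A x (w x) = r x`, where `A p` is the
identity. -/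
theorem hasFDerivAt_of_clm_apply_eventuallyEq [CompleteSpace E] {A : E → E →L[ℝ] E}
    {A' : E →L[ℝ] E →L[ℝ] E} {w r : E → E} {r' : E →L[ℝ] E} {p : E} (hA : HasFDerivAt A A' p)
    (hAp : A p = ContinuousLinearMap.id ℝ E) (hr : HasFDerivAt r r' p)
    (h : ∀ᶠ x in 𝓝 p, A x (w x) = r x) :
    HasFDerivAt w (r' - A'.flip (w p)) p := by
  have hinv : DifferentiableAt ℝ (fun x => (A x).inverse) p := by
    have h1 : ContDiffAt ℝ 1 (ContinuousLinearMap.inverse : (E →L[ℝ] E) → (E →L[ℝ] E)) (A p) := by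
      rw [hAp]
      exact contDiffAt_map_inverse (ContinuousLinearEquiv.refl ℝ E)
    exact (h1.differentiableAt (by simp)).comp p hA.differentiableAt
  have hunit : ∀ᶠ x in 𝓝 p, IsUnit (A x) := by
    have : {f : E →L[ℝ] E | IsUnit f} ∈ 𝓝 (A p) := by
      rw [hAp]
      exact Units.isOpen.mem_nhds isUnit_one
    exact hA.continuousAt this
  have hw : w =ᶠ[𝓝 p] fun x => (A x).inverse (r x) := by
    filter_upwards [h, hunit] with x hx ⟨u, hu⟩
    have e : A x = (ContinuousLinearEquiv.unitsEquiv ℝ E u : E ≃L[ℝ] E) := by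
      ext v; simp [← hu]
    rw [← hx, e, ContinuousLinearMap.inverse_equiv]
    exact (ContinuousLinearEquiv.symm_apply_apply _ _).symm
  have hd : DifferentiableAt ℝ w p :=
    (hinv.clm_apply hr.differentiableAt).congr_of_eventuallyEq hw
  have h3 := (hA.clm_apply hd.hasFDerivAt).congr_of_eventuallyEq
    (show r =ᶠ[𝓝 p] fun x => A x (w x) from h.mono fun x hx => hx.symm)
  have h4 := hr.unique h3
  refine hd.hasFDerivAt.congr_fderiv ?_
  rw [h4, hAp]
  ext; simp

end SecondOrder

section Chart

variable {E : Type*} [NormedAddCommGroup E] [NormedSpace ℝ E]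
  {G : Type*} [TopologicalSpace G] [ChartedSpace E G] [Group G]

variable (E G) in
/-- The position of the identity in its preferred chart. -/
noncomputable def chartOne : E := extChartAt 𝓘(ℝ, E) (1 : G) 1

variable (E G) in
/-- The multiplication of `G` read in the preferred chart at the identity. -/
noncomputable def mulChart (q : E × E) : E :=
  extChartAt 𝓘(ℝ, E) (1 : G)
    ((extChartAt 𝓘(ℝ, E) (1 : G)).symm q.1 * (extChartAt 𝓘(ℝ, E) (1 : G)).symm q.2)

variable (G) in
/-- The differential of the preferred chart at the identity, at the point with coordinate `x`. -/
noncomputable def chartDeriv (x : E) : E →L[ℝ] E :=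
  mfderiv 𝓘(ℝ, E) 𝓘(ℝ, E) (extChartAt 𝓘(ℝ, E) (1 : G)) ((extChartAt 𝓘(ℝ, E) (1 : G)).symm x)

/-- A vector field on `G` as an `E`-valued function, through the definitional equality of the
tangent spaces with `E`. -/
def fieldValue (V : (g : G) → TangentSpace 𝓘(ℝ, E) g) (g : G) : E := V g

/-- A vector field read in the preferred chart at the identity. -/
noncomputable def chartField (V : (g : G) → TangentSpace 𝓘(ℝ, E) g) (x : E) : E :=
  chartDeriv G x (fieldValue V ((extChartAt 𝓘(ℝ, E) (1 : G)).symm x))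

theorem extChartAt_symm_chartOne :
    (extChartAt 𝓘(ℝ, E) (1 : G)).symm (chartOne E G) = 1 := by
  simp [chartOne]

theorem eventually_mem_target :
    ∀ᶠ x in 𝓝 (chartOne E G), x ∈ (extChartAt 𝓘(ℝ, E) (1 : G)).target :=
  extChartAt_target_mem_nhds (I := 𝓘(ℝ, E)) (1 : G)

variable [LieGroup 𝓘(ℝ, E) ∞ G]

theorem contDiffAt_mulChart : ContDiffAt ℝ ∞ (mulChart E G) (chartOne E G, chartOne E G) := by
  have hs : ContMDiffAt 𝓘(ℝ, E) 𝓘(ℝ, E) ∞ (extChartAt 𝓘(ℝ, E) (1 : G)).symm (chartOne E G) :=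
    (contMDiffOn_extChartAt_symm (1 : G)).contMDiffAt eventually_mem_target
  have h1 : ContMDiffAt (𝓘(ℝ, E).prod 𝓘(ℝ, E)) 𝓘(ℝ, E) ∞ (fun q : E × E =>
      (extChartAt 𝓘(ℝ, E) (1 : G)).symm q.1 * (extChartAt 𝓘(ℝ, E) (1 : G)).symm q.2)
      (chartOne E G, chartOne E G) :=
    (ContMDiffAt.comp (chartOne E G, chartOne E G) hs contMDiffAt_fst).mul
      (ContMDiffAt.comp (chartOne E G, chartOne E G) hs contMDiffAt_snd)
  have h2 : ContMDiffAt (𝓘(ℝ, E).prod 𝓘(ℝ, E)) 𝓘(ℝ, E) ∞ (mulChart E G)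
      (chartOne E G, chartOne E G) := by
    refine ContMDiffAt.comp _ (g := extChartAt 𝓘(ℝ, E) (1 : G)) ?_ h1
    simp only [extChartAt_symm_chartOne, mul_one]
    exact contMDiffAt_extChartAt
  rwa [← modelWithCornersSelf_prod, chartedSpaceSelf_prod, contMDiffAt_iff_contDiffAt] at h2

theorem hasMFDerivAt_extChartAt_symm_chartOne :
    HasMFDerivAt 𝓘(ℝ, E) 𝓘(ℝ, E) (extChartAt 𝓘(ℝ, E) (1 : G)).symm (chartOne E G)
      (ContinuousLinearMap.id ℝ E) := by
  have hs : ContMDiffAt 𝓘(ℝ, E) 𝓘(ℝ, E) ∞ (extChartAt 𝓘(ℝ, E) (1 : G)).symm (chartOne E G) :=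
    (contMDiffOn_extChartAt_symm (1 : G)).contMDiffAt eventually_mem_target
  refine HasMFDerivAt.congr_mfderiv (hs.mdifferentiableAt (by simp)).hasMFDerivAt ?_
  rw [← mfderivWithin_univ]
  have h := mfderivWithin_range_extChartAt_symm (I := 𝓘(ℝ, E)) (x := (1 : G))
  rw [modelWithCornersSelf_coe, Set.range_id] at h
  exact h

theorem chartDeriv_chartOne : chartDeriv G (chartOne E G) = ContinuousLinearMap.id ℝ E := by
  rw [chartDeriv, extChartAt_symm_chartOne]
  exact mfderiv_extChartAt_self

theorem hasMFDerivAt_chartDeriv {x : E} (hx : x ∈ (extChartAt 𝓘(ℝ, E) (1 : G)).target) :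
    HasMFDerivAt 𝓘(ℝ, E) 𝓘(ℝ, E) (extChartAt 𝓘(ℝ, E) (1 : G))
      ((extChartAt 𝓘(ℝ, E) (1 : G)).symm x) (chartDeriv G x : E →L[ℝ] E) := by
  have h := (extChartAt 𝓘(ℝ, E) (1 : G)).map_target hx
  rw [extChartAt_source] at h
  exact (mdifferentiableAt_extChartAt h).hasMFDerivAt

theorem eventually_differentiableAt_mulChart_left :
    ∀ᶠ x in 𝓝 (chartOne E G), DifferentiableAt ℝ (mulChart E G) (x, chartOne E G) := by
  have h := ((contDiffAt_mulChart (E := E) (G := G)).of_le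
    (show (1 : ℕ∞ω) ≤ ∞ by norm_cast)).eventually (by simp)
  have hc : ContinuousAt (fun x : E => (x, chartOne E G)) (chartOne E G) := by fun_prop
  exact (hc.eventually h).mono fun x hx => hx.differentiableAt (by simp)

theorem eventually_differentiableAt_mulChart_right :
    ∀ᶠ x in 𝓝 (chartOne E G), DifferentiableAt ℝ (mulChart E G) (chartOne E G, x) := by
  have h := ((contDiffAt_mulChart (E := E) (G := G)).of_le
    (show (1 : ℕ∞ω) ≤ ∞ by norm_cast)).eventually (by simp)
  have hc : ContinuousAt (fun x : E => (chartOne E G, x)) (chartOne E G) := by fun_prop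
  exact (hc.eventually h).mono fun x hx => hx.differentiableAt (by simp)

/-- The partial derivatives of the multiplication in the chart are the differentials of the
translations. The tangent space at the point of coordinate `x` is identified with `E` by its own
preferred chart, which explains the factor `chartDeriv`. -/
theorem eventually_fderiv_mulChart_left :
    ∀ᶠ x in 𝓝 (chartOne E G), ∀ Y, fderiv ℝ (mulChart E G) (x, chartOne E G) (0, Y) =
      chartDeriv G x (leftDeriv ((extChartAt 𝓘(ℝ, E) (1 : G)).symm x) 1 Y) := by
  filter_upwards [eventually_mem_target (E := E) (G := G),
    eventually_differentiableAt_mulChart_left (E := E) (G := G)] with x hx hd Y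
  set g := (extChartAt 𝓘(ℝ, E) (1 : G)).symm x with hg
  have h1 : HasFDerivAt (fun y => mulChart E G (x, y)) _ (chartOne E G) :=
    HasFDerivAt.comp (g := mulChart E G) (f := fun y => (x, y)) (chartOne E G) hd.hasFDerivAt
      (hasFDerivAt_prodMk_right x (chartOne E G))
  have h2 := hasMFDerivAt_leftDeriv (E := E) g 1
  have h3 := hasMFDerivAt_chartDeriv (E := E) (G := G) hx
  rw [← extChartAt_symm_chartOne (E := E) (G := G)] at h2
  have h4 := h2.comp _ (hasMFDerivAt_extChartAt_symm_chartOne (E := E) (G := G))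
  have e : (extChartAt 𝓘(ℝ, E) (1 : G)).symm x =
    ((fun y => g * y) ∘ (extChartAt 𝓘(ℝ, E) (1 : G)).symm) (chartOne E G) := by
    simp only [Function.comp, extChartAt_symm_chartOne, mul_one, hg]
  rw [e] at h3
  have h5 := h3.comp _ h4
  have h6 := h1.unique h5.hasFDerivAt
  have h7 := DFunLike.congr_fun h6 Y
  rw [extChartAt_symm_chartOne] at h7
  simpa using! h7

theorem eventually_fderiv_mulChart_right :
    ∀ᶠ x in 𝓝 (chartOne E G), ∀ Y, fderiv ℝ (mulChart E G) (chartOne E G, x) (Y, 0) =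
      chartDeriv G x (rightDeriv ((extChartAt 𝓘(ℝ, E) (1 : G)).symm x) 1 Y) := by
  filter_upwards [eventually_mem_target (E := E) (G := G),
    eventually_differentiableAt_mulChart_right (E := E) (G := G)] with x hx hd Y
  set g := (extChartAt 𝓘(ℝ, E) (1 : G)).symm x with hg
  have h1 : HasFDerivAt (fun y => mulChart E G (y, x)) _ (chartOne E G) :=
    HasFDerivAt.comp (g := mulChart E G) (f := fun y => (y, x)) (chartOne E G) hd.hasFDerivAt
      (hasFDerivAt_prodMk_left (chartOne E G) x)
  have h2 := hasMFDerivAt_rightDeriv (E := E) g 1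
  have h3 := hasMFDerivAt_chartDeriv (E := E) (G := G) hx
  rw [← extChartAt_symm_chartOne (E := E) (G := G)] at h2
  have h4 := h2.comp _ (hasMFDerivAt_extChartAt_symm_chartOne (E := E) (G := G))
  have e : (extChartAt 𝓘(ℝ, E) (1 : G)).symm x =
    ((fun y => y * g) ∘ (extChartAt 𝓘(ℝ, E) (1 : G)).symm) (chartOne E G) := by
    simp only [Function.comp, extChartAt_symm_chartOne, one_mul, hg]
  rw [e] at h3
  have h5 := h3.comp _ h4
  have h6 := h1.unique h5.hasFDerivAt
  have h7 := DFunLike.congr_fun h6 Y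
  rw [extChartAt_symm_chartOne] at h7
  simpa using! h7

theorem mpullbackWithin_eventuallyEq_chartField
    (V : (g : G) → TangentSpace 𝓘(ℝ, E) g) :
    VectorField.mpullbackWithin 𝓘(ℝ, E) 𝓘(ℝ, E) (extChartAt 𝓘(ℝ, E) (1 : G)).symm V
      (Set.range 𝓘(ℝ, E)) =ᶠ[𝓝 (chartOne E G)] chartField V := by
  filter_upwards [eventually_mem_target (E := E) (G := G)] with x hx
  rw [VectorField.mpullbackWithin_apply, ContinuousLinearMap.inverse_eq
    (mfderivWithin_extChartAt_symm_comp_mfderiv_extChartAt hx)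
    (mfderiv_extChartAt_comp_mfderivWithin_extChartAt_symm hx)]
  rfl

theorem mlieBracket_one_eq (V W : (g : G) → TangentSpace 𝓘(ℝ, E) g) :
    (VectorField.mlieBracket 𝓘(ℝ, E) V W (1 : G) : E) =
      fderiv ℝ (chartField W) (chartOne E G) (fieldValue V 1) -
        fderiv ℝ (chartField V) (chartOne E G) (fieldValue W 1) := by
  have hV1 (V : (g : G) → TangentSpace 𝓘(ℝ, E) g) :
      chartField V (chartOne E G) = fieldValue V 1 := by
    rw [chartField, chartDeriv_chartOne, extChartAt_symm_chartOne]
    rfl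
  have h0 : (VectorField.mlieBracket 𝓘(ℝ, E) V W (1 : G) : E) =
      VectorField.lieBracket ℝ
        (VectorField.mpullbackWithin 𝓘(ℝ, E) 𝓘(ℝ, E) (extChartAt 𝓘(ℝ, E) (1 : G)).symm V
          (Set.range 𝓘(ℝ, E)))
        (VectorField.mpullbackWithin 𝓘(ℝ, E) 𝓘(ℝ, E) (extChartAt 𝓘(ℝ, E) (1 : G)).symm W
          (Set.range 𝓘(ℝ, E))) (chartOne E G) := by
    have hinv : ((mfderiv 𝓘(ℝ, E) 𝓘(ℝ, E) (extChartAt 𝓘(ℝ, E) (1 : G)) (1 : G) :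
        E →L[ℝ] E)).inverse = ContinuousLinearMap.id ℝ E :=
      (congrArg ContinuousLinearMap.inverse
        (mfderiv_extChartAt_self (I := 𝓘(ℝ, E)) (x := (1 : G)))).trans
        ContinuousLinearMap.inverse_id
    have hset : (extChartAt 𝓘(ℝ, E) (1 : G)).symm ⁻¹' Set.univ ∩ Set.range 𝓘(ℝ, E) =
        Set.univ := by
      rw [modelWithCornersSelf_coe, Set.range_id, Set.preimage_univ, Set.univ_inter]
    have h1 (V' W' : E → E) : VectorField.lieBracketWithin ℝ V' W'
        ((extChartAt 𝓘(ℝ, E) (1 : G)).symm ⁻¹' Set.univ ∩ Set.range 𝓘(ℝ, E)) (chartOne E G) =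
        VectorField.lieBracket ℝ V' W' (chartOne E G) := by
      rw [hset, VectorField.lieBracketWithin_univ]
    exact (DFunLike.congr_fun hinv _).trans (h1 _ _)
  rw [h0, (mpullbackWithin_eventuallyEq_chartField V).lieBracket_vectorField_eq
    (mpullbackWithin_eventuallyEq_chartField W), VectorField.lieBracket, hV1, hV1]

theorem differentiableAt_chartField {V : (g : G) → TangentSpace 𝓘(ℝ, E) g} [CompleteSpace E]
    (hV : MDifferentiableAt 𝓘(ℝ, E) 𝓘(ℝ, E).tangent
      (fun g => (⟨g, V g⟩ : TangentBundle 𝓘(ℝ, E) G)) 1) :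
    DifferentiableAt ℝ (chartField V) (chartOne E G) := by
  have h : MDifferentiableWithinAt 𝓘(ℝ, E) 𝓘(ℝ, E).tangent
      (fun g => (⟨g, V g⟩ : TangentBundle 𝓘(ℝ, E) G)) Set.univ 1 :=
    hV.mdifferentiableWithinAt
  have h1 := h.differentiableWithinAt_mpullbackWithin_vectorField
  have hset : (extChartAt 𝓘(ℝ, E) (1 : G)).symm ⁻¹' Set.univ ∩ Set.range 𝓘(ℝ, E) =
      Set.univ := by
    rw [modelWithCornersSelf_coe, Set.range_id, Set.preimage_univ, Set.univ_inter]
  rw [hset] at h1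
  exact (differentiableWithinAt_univ.1 h1).congr_of_eventuallyEq (mpullbackWithin_eventuallyEq_chartField V).symm

theorem eventually_chartField_mulInvariantVectorField (X : E) :
    chartField (mulInvariantVectorField (I := 𝓘(ℝ, E)) (G := G) X) =ᶠ[𝓝 (chartOne E G)]
      fun x => fderiv ℝ (mulChart E G) (x, chartOne E G) (0, X) := by
  filter_upwards [eventually_fderiv_mulChart_left (E := E) (G := G)] with x hx
  exact (hx X).symm

variable (G) in
/-- The operator `ad X` of the Lie algebra of `G`, in terms of the second derivative at the identity
of the multiplication of `G`. -/
noncomputable def lieAd (X : E) : E →L[ℝ] E :=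
  (fderiv ℝ (fderiv ℝ (mulChart E G)) (chartOne E G, chartOne E G) (X, 0)).comp
      (ContinuousLinearMap.inr ℝ E E) -
    ((fderiv ℝ (fderiv ℝ (mulChart E G)) (chartOne E G, chartOne E G)).flip (0, X)).comp
      (ContinuousLinearMap.inl ℝ E E)

omit [LieGroup 𝓘(ℝ, E) ∞ G] in
theorem lieAd_apply (X Y : E) : lieAd G X Y = mixedDeriv (mulChart E G) (chartOne E G) X Y -
    mixedDeriv (mulChart E G) (chartOne E G) Y X := rfl

omit [LieGroup 𝓘(ℝ, E) ∞ G] in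
theorem lieAd_swap (X Y : E) : lieAd G X Y = -lieAd G Y X := by
  simp [lieAd_apply]

/-- The bracket of the Lie algebra is the antisymmetric part of the second derivative of the
multiplication. -/
theorem bracket_eq_lieAd (X Y : GroupLieAlgebra 𝓘(ℝ, E) G) : ⁅X, Y⁆ = lieAd (E := E) G X Y := by
  have h (X : E) :
      fieldValue (mulInvariantVectorField (I := 𝓘(ℝ, E)) (G := G) X) (1 : G) = X :=
    DFunLike.congr_fun (leftDeriv_one (E := E) (1 : G)) X
  have h1 (X Y : E) :
      fderiv ℝ (chartField (mulInvariantVectorField (I := 𝓘(ℝ, E)) (G := G) Y)) (chartOne E G)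
          (fieldValue (mulInvariantVectorField (I := 𝓘(ℝ, E)) (G := G) X) 1) -
        fderiv ℝ (chartField (mulInvariantVectorField (I := 𝓘(ℝ, E)) (G := G) X)) (chartOne E G)
          (fieldValue (mulInvariantVectorField (I := 𝓘(ℝ, E)) (G := G) Y) 1) =
      lieAd G X Y := by
    rw [(eventually_chartField_mulInvariantVectorField X).fderiv_eq,
      (eventually_chartField_mulInvariantVectorField Y).fderiv_eq,
      (hasFDerivAt_fderiv_snd contDiffAt_mulChart _).fderiv,
      (hasFDerivAt_fderiv_snd contDiffAt_mulChart _).fderiv, h, h]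
    rfl
  exact (mlieBracket_one_eq (mulInvariantVectorField X) (mulInvariantVectorField Y)).trans (h1 X Y)

/-- Let `r` be a vector field read in the chart, and let `w : G → E` be the same field translated on
the right to the identity. The derivatives of `w` and `r` at the identity differ by a term that
depends only on the value `w 1`. -/
theorem hasFDerivAt_rightDeriv_inv_comp_chart [CompleteSpace E] {w : G → E} {r : E → E}
    {r' : E →L[ℝ] E} (hr : HasFDerivAt r r' (chartOne E G))
    (h : ∀ᶠ x in 𝓝 (chartOne E G),
      chartDeriv G x (rightDeriv ((extChartAt 𝓘(ℝ, E) (1 : G)).symm x) 1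
        (w ((extChartAt 𝓘(ℝ, E) (1 : G)).symm x))) = r x) :
    ∃ L : E →L[ℝ] E, HasFDerivAt
      (fun x => w ((extChartAt 𝓘(ℝ, E) (1 : G)).symm x)) L (chartOne E G) ∧
      ∀ X : E, L X = r' X - mixedDeriv (mulChart E G) (chartOne E G) (w 1) X := by
  refine ⟨_, hasFDerivAt_of_clm_apply_eventuallyEq
    (hasFDerivAt_fderiv_fst contDiffAt_mulChart) ?_ hr ?_, ?_⟩
  · ext Y
    have := (eventually_fderiv_mulChart_right (E := E) (G := G)).self_of_nhds Y
    rw [extChartAt_symm_chartOne, rightDeriv_one, chartDeriv_chartOne] at this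
    simpa using this
  · filter_upwards [h, eventually_fderiv_mulChart_right (E := E) (G := G)] with x hx hx'
    rw [← hx, ← hx']
    rfl
  · intro X
    rw [extChartAt_symm_chartOne, ← fderiv_fderiv_inr_inl contDiffAt_mulChart]
    rfl

/-- The derivative at the identity of the adjoint representation is the bracket. -/
theorem hasFDerivAt_adjoint_comp_chart [CompleteSpace E] (Y : E) :
    HasFDerivAt (fun x => adjoint ((extChartAt 𝓘(ℝ, E) (1 : G)).symm x) Y) (-lieAd G Y)
      (chartOne E G) := by
  obtain ⟨L, hL, h⟩ := hasFDerivAt_rightDeriv_inv_comp_chart (w := fun g : G => adjoint g Y)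
    (hasFDerivAt_fderiv_snd contDiffAt_mulChart Y) (by
      filter_upwards [eventually_fderiv_mulChart_left (E := E) (G := G)] with x hx
      rw [hx, rightDeriv_adjoint])
  refine hL.congr_fderiv (ContinuousLinearMap.ext fun X => ?_)
  rw [h, adjoint_one]
  change _ = -(lieAd G Y X)
  rw [← lieAd_swap, lieAd_apply]
  rfl

/-- If `V` vanishes at the identity, then its bracket at the identity with another field `W`
depends only on the value of `W`; it is given by the derivative at the identity of `V`, which can
be computed after right translation to the identity. -/
theorem hasFDerivAt_comp_chart_of_eq_zero [CompleteSpace E]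
    {V : (g : G) → TangentSpace 𝓘(ℝ, E) g} (hV1 : fieldValue V 1 = 0)
    (hV : MDifferentiableAt 𝓘(ℝ, E) 𝓘(ℝ, E).tangent
      (fun g => (⟨g, V g⟩ : TangentBundle 𝓘(ℝ, E) G)) 1) :
    ∃ L : E →L[ℝ] E, HasFDerivAt
      (fun x => rightDeriv ((extChartAt 𝓘(ℝ, E) (1 : G)).symm x)⁻¹
        ((extChartAt 𝓘(ℝ, E) (1 : G)).symm x) (fieldValue V ((extChartAt 𝓘(ℝ, E) (1 : G)).symm x)))
      L (chartOne E G) ∧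
      ∀ W : (g : G) → TangentSpace 𝓘(ℝ, E) g,
        (VectorField.mlieBracket 𝓘(ℝ, E) V W (1 : G) : E) = -L (fieldValue W 1) := by
  obtain ⟨L, hL, h⟩ := hasFDerivAt_rightDeriv_inv_comp_chart
    (w := fun g : G => rightDeriv g⁻¹ g (fieldValue V g)) (differentiableAt_chartField hV).hasFDerivAt (by
      refine Filter.Eventually.of_forall fun x => ?_
      rw [rightDeriv_rightDeriv_inv]
      rfl)
  refine ⟨L, hL, fun W => ?_⟩
  have h0 (X : E) : mixedDeriv (mulChart E G) (chartOne E G) 0 X = 0 := by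
    rw [mixedDeriv, Prod.mk_zero_zero, map_zero]
    rfl
  rw [mlieBracket_one_eq, h, hV1, map_zero, map_zero, h0, zero_sub, sub_zero]

end Chart
end AffineControl

/-! ### Linear fields with inner derivations -/

namespace AffineControl

section LinearFields

variable {E : Type*} [NormedAddCommGroup E] [NormedSpace ℝ E]
  {G : Type*} [TopologicalSpace G] [ChartedSpace E G] [Group G] [LieGroup 𝓘(ℝ, E) ∞ G]

/-- On a connected group, a cocycle with values in the adjoint representation vanishes as soon as
its derivative at the identity vanishes. -/
theorem cocycle_eq_zero [ConnectedSpace G] {c : G → E}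
    (hc : ∀ g h, c (g * h) = c g + adjoint g (c h))
    (hd : HasFDerivAt (fun x => c ((extChartAt 𝓘(ℝ, E) (1 : G)).symm x)) (0 : E →L[ℝ] E)
      (chartOne E G)) (g : G) : c g = 0 := by
  have hc1 : c 1 = 0 := by
    have := hc 1 1
    rw [mul_one, adjoint_one] at this
    simpa using this
  -- the derivative of the cocycle vanishes at `1`, and then everywhere by translation
  have h1 : HasMFDerivAt 𝓘(ℝ, E) 𝓘(ℝ, E) c (1 : G) (0 : E →L[ℝ] E) := by
    have hφ := hasMFDerivAt_chartDeriv (E := E) (G := G)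
      (eventually_mem_target (E := E) (G := G)).self_of_nhds
    rw [extChartAt_symm_chartOne] at hφ
    have h2 := HasMFDerivAt.comp (1 : G) (I'' := 𝓘(ℝ, E)) hd.hasMFDerivAt hφ
    refine HasMFDerivAt.congr_mfderiv (h2.congr_of_eventuallyEq ?_)
      (ContinuousLinearMap.zero_comp _)
    filter_upwards [extChartAt_source_mem_nhds (I := 𝓘(ℝ, E)) (1 : G)] with x hx
    simp only [Function.comp, (extChartAt 𝓘(ℝ, E) (1 : G)).left_inv hx]
  have h2 (g : G) : HasMFDerivAt 𝓘(ℝ, E) 𝓘(ℝ, E) c g (0 : E →L[ℝ] E) := by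
    have hl := hasMFDerivAt_leftDeriv (E := E) g⁻¹ g
    rw [← inv_mul_cancel g] at h1
    have h3 := HasMFDerivAt.comp g (I'' := 𝓘(ℝ, E)) h1 hl
    have ha : HasFDerivAt (fun v : E => c g + adjoint g v) (adjoint g : E →L[ℝ] E) (c (g⁻¹ * g)) :=
      (adjoint g : E →L[ℝ] E).hasFDerivAt.const_add _
    have h4 := HasMFDerivAt.comp g (I'' := 𝓘(ℝ, E)) ha.hasMFDerivAt h3
    have e : (fun v : E => c g + adjoint g v) ∘ c ∘ (fun x => g⁻¹ * x) = c := by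
      ext x
      simp [← hc]
    rw [e] at h4
    refine HasMFDerivAt.congr_mfderiv h4 ?_
    ext v
    exact map_zero (adjoint g : E →L[ℝ] E)
  -- hence the cocycle vanishes near `1`
  obtain ⟨ε, hε, hball⟩ := Metric.mem_nhds_iff.1 (eventually_mem_target (E := E) (G := G))
  have h3 : ∀ x ∈ Metric.ball (chartOne E G) ε,
      c ((extChartAt 𝓘(ℝ, E) (1 : G)).symm x) = 0 := by
    intro x hx
    have hder : ∀ y ∈ Metric.ball (chartOne E G) ε,
        HasFDerivWithinAt (fun y => c ((extChartAt 𝓘(ℝ, E) (1 : G)).symm y)) (0 : E →L[ℝ] E)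
          (Metric.ball (chartOne E G) ε) y := by
      intro y hy
      have hs : MDifferentiableAt 𝓘(ℝ, E) 𝓘(ℝ, E) (extChartAt 𝓘(ℝ, E) (1 : G)).symm y :=
        ((contMDiffOn_extChartAt_symm (n := ∞) (1 : G)).contMDiffAt
          (extChartAt_target_mem_nhds' (hball hy))).mdifferentiableAt (by simp)
      have h5 := HasMFDerivAt.comp y (I'' := 𝓘(ℝ, E)) (h2 _) hs.hasMFDerivAt
      have h6 : HasMFDerivAt 𝓘(ℝ, E) 𝓘(ℝ, E)
          (c ∘ (extChartAt 𝓘(ℝ, E) (1 : G)).symm) y (0 : E →L[ℝ] E) :=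
        HasMFDerivAt.congr_mfderiv h5 (ContinuousLinearMap.zero_comp _)
      exact h6.hasFDerivAt.hasFDerivWithinAt
    have := (convex_ball (chartOne E G) ε).is_const_of_fderivWithin_eq_zero (𝕜 := ℝ)
      (fun y hy => (hder y hy).differentiableWithinAt)
      (fun y hy => (hder y hy).fderivWithin (Metric.isOpen_ball.uniqueDiffWithinAt hy))
      hx (Metric.mem_ball_self hε)
    rw [this, extChartAt_symm_chartOne, hc1]
  have h4 : ∀ᶠ x in 𝓝 (1 : G), c x = 0 := by
    have hφ : ContinuousAt (extChartAt 𝓘(ℝ, E) (1 : G)) 1 := continuousAt_extChartAt 1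
    filter_upwards [extChartAt_source_mem_nhds (I := 𝓘(ℝ, E)) (1 : G),
      hφ.preimage_mem_nhds (Metric.ball_mem_nhds _ hε)] with x hx hx'
    have := h3 _ hx'
    rwa [(extChartAt 𝓘(ℝ, E) (1 : G)).left_inv hx] at this
  -- the zeros of the cocycle form an open subgroup
  have : IsTopologicalGroup G := topologicalGroup_of_lieGroup 𝓘(ℝ, E) ∞
  let S : Subgroup G :=
    { carrier := {x | c x = 0}
      one_mem' := hc1
      mul_mem' := by
        intro x y (hx : c x = 0) (hy : c y = 0)
        simp [hc, hx, hy]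
      inv_mem' := by
        intro x (hx : c x = 0)
        have := hc x⁻¹ x
        rw [inv_mul_cancel, hc1, hx, map_zero, add_zero] at this
        exact this.symm }
  have hopen : IsOpen (S : Set G) := S.isOpen_of_mem_nhds (g := 1) h4
  have huniv := IsClopen.eq_univ ⟨S.isClosed_of_isOpen hopen, hopen⟩ ⟨1, S.one_mem⟩
  exact (huniv ▸ Set.mem_univ g : g ∈ (S : Set G))

theorem IsLinearField.fieldValue_mul {𝒳 : (g : G) → TangentSpace 𝓘(ℝ, E) g}
    (h : IsLinearField 𝓘(ℝ, E) 𝒳) (g k : G) :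
    fieldValue 𝒳 (g * k) = rightDeriv k g (fieldValue 𝒳 g) + leftDeriv g k (fieldValue 𝒳 k) :=
  h.2 g k

theorem IsLinearField.fieldValue_one {𝒳 : (g : G) → TangentSpace 𝓘(ℝ, E) g}
    (h : IsLinearField 𝓘(ℝ, E) 𝒳) : fieldValue 𝒳 1 = 0 := by
  have := h.fieldValue_mul 1 1
  rw [leftDeriv_one, rightDeriv_one, mul_one] at this
  simpa using this

/-- A linear field translated on the right to the identity is a cocycle for the adjoint
representation. -/
theorem IsLinearField.cocycle {𝒳 : (g : G) → TangentSpace 𝓘(ℝ, E) g}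
    (h : IsLinearField 𝓘(ℝ, E) 𝒳) (g k : G) :
    rightDeriv (g * k)⁻¹ (g * k) (fieldValue 𝒳 (g * k)) =
      rightDeriv g⁻¹ g (fieldValue 𝒳 g) +
        adjoint g (rightDeriv k⁻¹ k (fieldValue 𝒳 k)) := by
  have h1 (v : E) : rightDeriv (g * k)⁻¹ (g * k) (rightDeriv k g v) = rightDeriv g⁻¹ g v := by
    rw [rightDeriv_rightDeriv, mul_inv_rev, mul_inv_cancel_left]
  have h2 := rightDeriv_leftDeriv (E := E) g k 1 (rightDeriv k⁻¹ k (fieldValue 𝒳 k))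
  rw [rightDeriv_rightDeriv_inv, mul_one, one_mul] at h2
  rw [h.fieldValue_mul, map_add, h1, ← h2, h1]
  rfl

theorem IsLinearField.mdifferentiableAt {𝒳 : (g : G) → TangentSpace 𝓘(ℝ, E) g}
    (h : IsLinearField 𝓘(ℝ, E) 𝒳) (g : G) :
    MDifferentiableAt 𝓘(ℝ, E) 𝓘(ℝ, E).tangent
      (fun g => (⟨g, 𝒳 g⟩ : TangentBundle 𝓘(ℝ, E) G)) g :=
  h.1.mdifferentiableAt (by simp)

variable [CompleteSpace E]

/-- A linear field with inner derivation `ad X`, translated to the identity, has derivative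
`ad X` at the identity. -/
theorem IsLinearField.hasFDerivAt {𝒳 : (g : G) → TangentSpace 𝓘(ℝ, E) g}
    {X : E} (h : IsLinearField 𝓘(ℝ, E) 𝒳)
    (hX : DerivationEqAd 𝓘(ℝ, E) 𝒳 X) :
    HasFDerivAt
      (fun x => rightDeriv ((extChartAt 𝓘(ℝ, E) (1 : G)).symm x)⁻¹
        ((extChartAt 𝓘(ℝ, E) (1 : G)).symm x)
        (fieldValue 𝒳 ((extChartAt 𝓘(ℝ, E) (1 : G)).symm x)))
      (lieAd G X) (chartOne E G) ∧
      ∀ W : (g : G) → TangentSpace 𝓘(ℝ, E) g,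
        fieldValue (VectorField.mlieBracket 𝓘(ℝ, E) 𝒳 W) (1 : G) =
          -lieAd G X (fieldValue W 1) := by
  obtain ⟨L, hL, hW⟩ := hasFDerivAt_comp_chart_of_eq_zero h.fieldValue_one (h.mdifferentiableAt 1)
  have hLX : L = lieAd G X := by
    ext Y
    let X' : GroupLieAlgebra 𝓘(ℝ, E) G := X
    let Y' : GroupLieAlgebra 𝓘(ℝ, E) G := Y
    have h1 : -fieldValue (VectorField.mlieBracket 𝓘(ℝ, E) 𝒳
        (rightInvariantField 𝓘(ℝ, E) (G := G) Y)) 1 =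
        rightDeriv (1 : G) 1 (lieAd G X Y) :=
      (hX Y 1).trans (congrArg (fun v => rightInvariantField 𝓘(ℝ, E) v (1 : G))
        (bracket_eq_lieAd X' Y'))
    have h2 : fieldValue (VectorField.mlieBracket 𝓘(ℝ, E) 𝒳
        (rightInvariantField 𝓘(ℝ, E) (G := G) Y)) 1 =
        -L (rightDeriv (E := E) (1 : G) 1 Y) := hW _
    rw [h2, neg_neg, rightDeriv_one] at h1
    exact h1
  subst hLX
  exact ⟨hL, hW⟩

/-- A linear field with inner derivation `ad X` is the difference of the right and left invariant
fields of value `X` at the identity. -/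
theorem IsLinearField.fieldValue_eq [ConnectedSpace G] {𝒳 : (g : G) → TangentSpace 𝓘(ℝ, E) g}
    {X : E} (h : IsLinearField 𝓘(ℝ, E) 𝒳)
    (hX : DerivationEqAd 𝓘(ℝ, E) 𝒳 X) (g : G) :
    fieldValue 𝒳 g = rightDeriv g 1 X - leftDeriv g 1 X := by
  have key := cocycle_eq_zero (G := G) (E := E)
    (c := fun g => rightDeriv g⁻¹ g (fieldValue 𝒳 g) - (X - adjoint g X)) (by
      intro g k
      rw [h.cocycle, adjoint_mul_apply, map_sub, map_sub]
      abel) (by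
      have h2 := (h.hasFDerivAt hX).1.sub ((hasFDerivAt_adjoint_comp_chart (G := G) X).const_sub X)
      refine h2.congr_fderiv ?_
      rw [neg_neg]
      exact sub_self _) g
  have h3 := congrArg (rightDeriv (E := E) g 1) (sub_eq_zero.1 key)
  rw [rightDeriv_rightDeriv_inv, map_sub, rightDeriv_adjoint] at h3
  exact h3

/-- Commuting linear fields have commuting derivations. -/
theorem IsLinearField.lieAd_comm {𝒳 𝒴 : (g : G) → TangentSpace 𝓘(ℝ, E) g}
    {X Y : E} (h𝒳 : IsLinearField 𝓘(ℝ, E) 𝒳)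
    (h𝒴 : IsLinearField 𝓘(ℝ, E) 𝒴) (hX : DerivationEqAd 𝓘(ℝ, E) 𝒳 X)
    (hY : DerivationEqAd 𝓘(ℝ, E) 𝒴 Y)
    (hcomm : ∀ g, VectorField.mlieBracket 𝓘(ℝ, E) 𝒳 𝒴 g = 0) (v : E) :
    lieAd G X (lieAd G Y v) = lieAd G Y (lieAd G X v) := by
  have h3 : minSmoothness ℝ 3 ≤ ∞ := by
    rw [minSmoothness_of_isRCLikeNormedField]
    exact WithTop.coe_le_coe.2 (le_top : (3 : ℕ∞) ≤ ⊤)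
  have h2 : minSmoothness ℝ 2 ≤ ∞ := by
    rw [minSmoothness_of_isRCLikeNormedField]
    exact WithTop.coe_le_coe.2 (le_top : (2 : ℕ∞) ≤ ⊤)
  have : LieGroup 𝓘(ℝ, E) (minSmoothness ℝ 3) G := LieGroup.of_le h3
  let W := mulInvariantVectorField (I := 𝓘(ℝ, E)) (G := G) v
  have hW : fieldValue W 1 = v := DFunLike.congr_fun (leftDeriv_one (E := E) (1 : G)) v
  have hzero : VectorField.mlieBracket 𝓘(ℝ, E) 𝒳 𝒴 = 0 := funext hcomm
  have hj := VectorField.leibniz_identity_mlieBracket_apply (x := (1 : G))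
    (h𝒳.1.contMDiffAt.of_le h2) (h𝒴.1.contMDiffAt.of_le h2)
    (contMDiffAt_mulInvariantVectorField (I := 𝓘(ℝ, E)) (G := G) v)
  rw [hzero, VectorField.mlieBracket_zero_left] at hj
  have hj' : fieldValue (VectorField.mlieBracket 𝓘(ℝ, E) 𝒳
      (VectorField.mlieBracket 𝓘(ℝ, E) 𝒴 W)) 1 = fieldValue (VectorField.mlieBracket 𝓘(ℝ, E) 𝒴
      (VectorField.mlieBracket 𝓘(ℝ, E) 𝒳 W)) 1 := hj.trans (zero_add _)
  rw [(h𝒳.hasFDerivAt hX).2, (h𝒴.hasFDerivAt hY).2, (h𝒴.hasFDerivAt hY).2,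
    (h𝒳.hasFDerivAt hX).2, hW, map_neg, map_neg, neg_neg, neg_neg] at hj'
  exact hj'

end LinearFields

end AffineControl

/-! ### One-parameter subgroups and the adjoint representation -/

namespace AffineControl

section OneParameter

variable {E : Type*} [NormedAddCommGroup E] [NormedSpace ℝ E]
  {G : Type*} [TopologicalSpace G] [ChartedSpace E G] [Group G]

/-- `B` is the integral curve through the identity of the right invariant field of value `X` at
the identity, that is, `B t = exp (t X)`. -/
def IsExpCurve (X : E) (B : ℝ → G) : Prop :=
  B 0 = 1 ∧ ∀ t, HasVelocity B (rightDeriv (B t) 1 X) t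

variable [LieGroup 𝓘(ℝ, E) ∞ G]

theorem contMDiff_mulInvariantVectorField_one (X : E) :
    ContMDiff 𝓘(ℝ, E) 𝓘(ℝ, E).tangent 1 (fun g => (⟨g,
      mulInvariantVectorField (I := 𝓘(ℝ, E)) (G := G) X g⟩ : TangentBundle 𝓘(ℝ, E) G)) := by
  have h3 : minSmoothness ℝ 3 ≤ ∞ := by
    rw [minSmoothness_of_isRCLikeNormedField]
    exact WithTop.coe_le_coe.2 (le_top : (3 : ℕ∞) ≤ ⊤)
  have : LieGroup 𝓘(ℝ, E) (minSmoothness ℝ 3) G := LieGroup.of_le h3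
  have h := contMDiff_mulInvariantVectorField (I := 𝓘(ℝ, E)) (G := G) X
  refine h.of_le ?_
  rw [minSmoothness_of_isRCLikeNormedField]
  exact one_le_two

variable [CompleteSpace E] [T2Space G]

/-- Left invariant fields are complete: the left translates of the integral curve at the identity
are integral curves defined for the same time. -/
theorem exists_leftInvariant_curve (X : E) :
    ∃ C : ℝ → G, C 0 = 1 ∧ ∀ t, HasVelocity C (leftDeriv (C t) 1 X) t := by
  have hX := contMDiff_mulInvariantVectorField_one (G := G) X
  have : IsManifold 𝓘(ℝ, E) 1 G := IsManifold.of_le (n := ∞) (by norm_cast)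
  obtain ⟨γ, hγ0, hγ⟩ := exists_isMIntegralCurveAt_of_contMDiffAt_boundaryless 0
    (hX.contMDiffAt (x := (1 : G)))
  rw [isMIntegralCurveAt_iff'] at hγ
  obtain ⟨ε, hε, hγ⟩ := hγ
  rw [Real.ball_eq_Ioo, zero_sub, zero_add] at hγ
  refine exists_isMIntegralCurve_of_isMIntegralCurveOn hX hε (fun g => ?_) 1
  refine ⟨fun t => g * γ t, by simp [hγ0], fun t ht => ?_⟩
  have h1 : HasVelocity γ (leftDeriv (γ t) 1 X) t := (hγ t ht).hasMFDerivAt (Ioo_mem_nhds ht.1 ht.2)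
  have h2 := h1.const_mul g
  have h3 := leftDeriv_leftDeriv (E := E) g (γ t) 1 X
  rw [mul_one] at h3
  rw [h3] at h2
  exact HasMFDerivAt.hasMFDerivWithinAt h2

omit [CompleteSpace E] in
theorem eq_of_leftInvariant_curve {X : E} {C D : ℝ → G} (h0 : C 0 = D 0)
    (hC : ∀ t, HasVelocity C (leftDeriv (C t) 1 X) t)
    (hD : ∀ t, HasVelocity D (leftDeriv (D t) 1 X) t) : C = D := by
  have : IsManifold 𝓘(ℝ, E) 1 G := IsManifold.of_le (n := ∞) (by norm_cast)
  exact isMIntegralCurve_Ioo_eq_of_contMDiff_boundaryless (t₀ := 0)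
    (contMDiff_mulInvariantVectorField_one (G := G) X) hC hD h0

theorem exists_isExpCurve (X : E) : ∃ B : ℝ → G, IsExpCurve X B := by
  obtain ⟨C, hC0, hC⟩ := exists_leftInvariant_curve (G := G) (-X)
  refine ⟨fun t => (C t)⁻¹, by simp [hC0], fun t => ?_⟩
  simpa using (hC t).inv_of_leftInvariant

omit [CompleteSpace E] in
/-- An element whose adjoint action fixes `X` commutes with `exp (t X)`. -/
theorem IsExpCurve.commute {X : E} {B : ℝ → G} (hB : IsExpCurve X B) {c : G}
    (hc : adjoint c X = X) (t : ℝ) : Commute c (B t) := by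
  -- `(B t)⁻¹` and `c * (B t)⁻¹ * c⁻¹` are integral curves of the same left invariant field
  have hc' : rightDeriv c⁻¹ 1 X = leftDeriv c⁻¹ 1 X := by
    rw [← rightDeriv_adjoint]
    nth_rw 2 [← hc]
    rw [adjoint_inv_adjoint]
  have hC (t : ℝ) : HasVelocity (fun s => (B s)⁻¹) (leftDeriv (B t)⁻¹ 1 (-X)) t := by
    simpa using (hB.2 t).inv_of_rightInvariant
  have hD (t : ℝ) : HasVelocity (fun s => c * (B s)⁻¹ * c⁻¹)
      (leftDeriv (c * (B t)⁻¹ * c⁻¹) 1 (-X)) t := by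
    have h1 := ((hC t).const_mul c).mul_const c⁻¹
    have h2 := leftDeriv_leftDeriv (E := E) c (B t)⁻¹ 1 (-X)
    have h3 := rightDeriv_leftDeriv (E := E) (c * (B t)⁻¹) c⁻¹ 1 (-X)
    have h4 := leftDeriv_leftDeriv (E := E) (c * (B t)⁻¹) c⁻¹ 1 (-X)
    rw [mul_one] at h2 h3 h4
    rw [one_mul, map_neg (rightDeriv c⁻¹ 1), hc', ← map_neg (leftDeriv c⁻¹ 1), h4] at h3
    rw [h2, h3] at h1
    exact h1
  have h := congrFun (eq_of_leftInvariant_curve (by simp [hB.1]) hC hD) t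
  have h' : (B t)⁻¹ * c = c * (B t)⁻¹ := by
    nth_rw 1 [h]
    rw [inv_mul_cancel_right]
  exact ((Commute.inv_left_iff (a := B t) (b := c)).1 h').symm

omit [T2Space G] in
theorem hasDerivAt_adjoint_of_eq_one {b : ℝ → G} {v : E} {t : ℝ} (hb : HasVelocity b v t)
    (h1 : b t = 1) (Y : E) : HasDerivAt (fun s => adjoint (b s) Y) (lieAd G v Y) t := by
  have hA := hasFDerivAt_adjoint_comp_chart (G := G) Y
  have hφ := hasMFDerivAt_chartDeriv (E := E) (G := G)
    (eventually_mem_target (E := E) (G := G)).self_of_nhds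
  rw [extChartAt_symm_chartOne, chartDeriv_chartOne] at hφ
  have hφ : HasMFDerivAt 𝓘(ℝ, E) 𝓘(ℝ, E) (extChartAt 𝓘(ℝ, E) (1 : G)) (b t)
      (ContinuousLinearMap.id ℝ E) := by
    rw [h1]
    exact hφ
  have h2 := HasMFDerivAt.comp t hφ hb
  have e : chartOne E G = (extChartAt 𝓘(ℝ, E) (1 : G) ∘ b) t := by
    simp [chartOne, h1]
  rw [e] at hA
  have h3 := (HasFDerivAt.comp t hA h2.hasFDerivAt).hasDerivAt
  have h4 : (-lieAd G Y ∘L ContinuousLinearMap.id ℝ E ∘L (1 : ℝ →L[ℝ] ℝ).smulRight v) 1 =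
      lieAd G v Y := by
    rw [lieAd_swap]
    simp
  refine (h4 ▸ h3).congr_of_eventuallyEq ?_
  have hs : (extChartAt 𝓘(ℝ, E) (1 : G)).source ∈ 𝓝 (b t) := by
    rw [h1]
    exact extChartAt_source_mem_nhds (1 : G)
  filter_upwards [hb.continuousAt hs] with s hs
  simp only [Function.comp, (extChartAt 𝓘(ℝ, E) (1 : G)).left_inv hs]

omit [T2Space G] in
theorem IsExpCurve.hasDerivAt_adjoint {X : E} {B : ℝ → G} (hB : IsExpCurve X B) (Y : E) (t : ℝ) :
    HasDerivAt (fun s => adjoint (B s) Y) (lieAd G X (adjoint (B t) Y)) t := by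
  have h1 := (hB.2 t).mul_const (B t)⁻¹
  rw [rightDeriv_inv_rightDeriv] at h1
  have h2 := hasDerivAt_adjoint_of_eq_one h1 (mul_inv_cancel _) (adjoint (B t) Y)
  simpa only [← adjoint_mul_apply, inv_mul_cancel_right] using h2

omit [T2Space G] in
/-- `Ad (exp (t X))` commutes with the operators that commute with `ad X`: the curves
`Ad (exp (t X)) (N v)` and `N (Ad (exp (t X)) v)` solve the linear equation `dw/dt = ad X w`
with the same initial value. -/
theorem IsExpCurve.adjoint_comm {X : E} {B : ℝ → G} (hB : IsExpCurve X B) {N : E →L[ℝ] E}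
    (hN : ∀ v, lieAd G X (N v) = N (lieAd G X v)) (t : ℝ) (v : E) :
    adjoint (B t) (N v) = N (adjoint (B t) v) := by
  have h := ODE_solution_unique_univ (v := fun _ => lieAd G X) (t₀ := 0)
    (f := fun s => adjoint (B s) (N v)) (g := fun s => N (adjoint (B s) v)) (s := fun _ => Set.univ)
    (K := ‖lieAd G X‖₊) (fun _ => (lieAd G X).lipschitz.lipschitzOnWith)
    (fun s => ⟨hB.hasDerivAt_adjoint (N v) s, trivial⟩)
    (fun s => ⟨by
      rw [hN]
      exact N.hasFDerivAt.comp_hasDerivAt s (hB.hasDerivAt_adjoint v s), trivial⟩)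
    (by simp [hB.1, adjoint_one])
  exact congrFun h t

end OneParameter

end AffineControl

/-! ### The subgroup generated by exponentials -/

namespace AffineControl

section ExpSubgroup

variable {E : Type*} [NormedAddCommGroup E] [NormedSpace ℝ E]
  {G : Type*} [TopologicalSpace G] [ChartedSpace E G] [Group G]

variable (G) in
/-- The subgroup of `G` generated by the exponentials of the real multiples of the elements
of `V`. -/
def expSubgroup (V : Set E) : Subgroup G :=
  Subgroup.closure {b | ∃ X ∈ V, ∃ B : ℝ → G, IsExpCurve X B ∧ ∃ t, B t = b}

theorem IsExpCurve.mem_expSubgroup {V : Set E} {X : E} (hX : X ∈ V) {B : ℝ → G}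
    (hB : IsExpCurve X B) (t : ℝ) : B t ∈ expSubgroup G V :=
  Subgroup.subset_closure ⟨X, hX, B, hB, t, rfl⟩

theorem exists_isPreconnected_of_mem_expSubgroup [IsTopologicalGroup G] {V : Set E} {x : G}
    (hx : x ∈ expSubgroup G V) :
    ∃ K : Set G, IsPreconnected K ∧ K ⊆ expSubgroup G V ∧ 1 ∈ K ∧ x ∈ K := by
  induction hx using Subgroup.closure_induction with
  | mem x hx =>
    obtain ⟨X, hX, B, hB, t, rfl⟩ := hx
    have hc : Continuous B := continuous_iff_continuousAt.2 fun t => (hB.2 t).continuousAt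
    refine ⟨Set.range B, isPreconnected_range hc, ?_, ⟨0, hB.1⟩, ⟨t, rfl⟩⟩
    rintro _ ⟨s, rfl⟩
    exact hB.mem_expSubgroup hX s
  | one => exact ⟨{1}, isPreconnected_singleton, by simp, rfl, rfl⟩
  | mul x y hx hy ihx ihy =>
    obtain ⟨K, hK, hKV, hK1, hxK⟩ := ihx
    obtain ⟨L, hL, hLV, hL1, hyL⟩ := ihy
    refine ⟨K ∪ (fun g => x * g) '' L, ?_, ?_, Or.inl hK1, Or.inr ⟨y, hyL, rfl⟩⟩
    · exact IsPreconnected.union x hxK ⟨1, hL1, mul_one x⟩ hK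
        (hL.image _ (continuous_const_mul x).continuousOn)
    · refine Set.union_subset hKV ?_
      rintro _ ⟨g, hg, rfl⟩
      exact Subgroup.mul_mem _ hx (hLV hg)
  | inv x hx ih =>
    obtain ⟨K, hK, hKV, hK1, hxK⟩ := ih
    refine ⟨(fun g => g⁻¹) '' K, hK.image _ continuous_inv.continuousOn, ?_,
      ⟨1, hK1, inv_one⟩, ⟨x, hxK, rfl⟩⟩
    rintro _ ⟨g, hg, rfl⟩
    exact Subgroup.inv_mem _ (hKV hg)

variable [LieGroup 𝓘(ℝ, E) ∞ G]

theorem adjoint_comm_of_mem_closure {S : Set G} {N : E →L[ℝ] E}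
    (h : ∀ b ∈ S, ∀ v, adjoint b (N v) = N (adjoint b v)) {x : G} (hx : x ∈ Subgroup.closure S)
    (v : E) : adjoint x (N v) = N (adjoint x v) := by
  induction hx using Subgroup.closure_induction generalizing v with
  | mem x hx => exact h x hx v
  | one => simp [adjoint_one]
  | mul x y hx hy ihx ihy => rw [adjoint_mul_apply, ihy, ihx, ← adjoint_mul_apply]
  | inv x hx ih =>
    have h1 := ih (adjoint x⁻¹ v)
    have h2 : adjoint x (adjoint x⁻¹ v) = v := by
      simpa using adjoint_inv_adjoint (E := E) x⁻¹ v
    rw [h2] at h1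
    rw [← h1, adjoint_inv_adjoint]

variable [CompleteSpace E]

theorem adjoint_comm_of_mem_expSubgroup {V : Set E}
    (hV : ∀ X ∈ V, ∀ Y ∈ V, ∀ v, lieAd G X (lieAd G Y v) = lieAd G Y (lieAd G X v))
    {x y : G} (hx : x ∈ expSubgroup G V) (hy : y ∈ expSubgroup G V) (v : E) :
    adjoint x (adjoint y v) = adjoint y (adjoint x v) := by
  have h1 : ∀ Y ∈ V, ∀ v, adjoint y (lieAd G Y v) = lieAd G Y (adjoint y v) := by
    intro Y hY
    refine adjoint_comm_of_mem_closure ?_ hy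
    rintro _ ⟨X, hX, B, hB, t, rfl⟩
    exact hB.adjoint_comm (hV X hX Y hY) t
  refine adjoint_comm_of_mem_closure ?_ hx v
  rintro _ ⟨X, hX, B, hB, t, rfl⟩
  exact hB.adjoint_comm (fun v => (h1 X hX v).symm) t

/-- If the derivations `ad X`, `X ∈ V`, commute, then the commutators of the subgroup generated
by the exponentials of `V` are central in it, since their adjoint action is trivial. -/
theorem commute_commutator_of_mem_expSubgroup [T2Space G] {V : Set E}
    (hV : ∀ X ∈ V, ∀ Y ∈ V, ∀ v, lieAd G X (lieAd G Y v) = lieAd G Y (lieAd G X v))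
    {x y z : G} (hx : x ∈ expSubgroup G V) (hy : y ∈ expSubgroup G V) (hz : z ∈ expSubgroup G V) :
    Commute (x * y * x⁻¹ * y⁻¹) z := by
  have hc (v : E) : adjoint (x * y * x⁻¹ * y⁻¹) v = v := by
    rw [adjoint_mul_apply, adjoint_mul_apply, adjoint_mul_apply,
      ← adjoint_comm_of_mem_expSubgroup hV (Subgroup.inv_mem _ hx) hy,
      adjoint_comm_of_mem_expSubgroup hV hx (Subgroup.inv_mem _ hx)]
    have h2 : adjoint y (adjoint y⁻¹ v) = v := by
      simpa using adjoint_inv_adjoint (E := E) y⁻¹ v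
    rw [h2, adjoint_inv_adjoint]
  have h1 : expSubgroup G V ≤ Subgroup.centralizer {x * y * x⁻¹ * y⁻¹} := by
    refine (Subgroup.closure_le _).2 ?_
    rintro _ ⟨X, hX, B, hB, t, rfl⟩
    exact Subgroup.mem_centralizer_singleton_iff.2 ((hB.commute (hc X) t).symm)
  exact (show Commute z _ from Subgroup.mem_centralizer_singleton_iff.1 (h1 hz)).symm

end ExpSubgroup

section PiecewiseConstant

variable {E : Type*} [NormedAddCommGroup E] [NormedSpace ℝ E]
  {G : Type*} [TopologicalSpace G] [ChartedSpace E G] [Group G] [LieGroup 𝓘(ℝ, E) ∞ G]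
  [CompleteSpace E] [T2Space G]

/-- For a function `X` of time with values in `V` that is locally constant outside of a finite set,
the equation `dB/dt = X(t) B`, written with right invariant fields, has a solution through the
identity, whose end point lies in the subgroup generated by the exponentials of `V`. -/
theorem exists_solution_of_locallyConstant {V : Set E} (X : ℝ → E) (hXV : ∀ t, X t ∈ V)
    (D : Finset ℝ) (a b : ℝ) (hab : a ≤ b)
    (hX : ∀ t ∈ Set.Ioo a b, t ∉ D → ∀ᶠ s in 𝓝 t, X s = X t) :
    ∃ B : ℝ → G, Continuous B ∧ B a = 1 ∧ B b ∈ expSubgroup G V ∧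
      ∀ t ∈ Set.Ioo a b, t ∉ D → HasVelocity B (rightDeriv (B t) 1 (X t)) t := by
  have : IsTopologicalGroup G := topologicalGroup_of_lieGroup 𝓘(ℝ, E) ∞
  induction D using Finset.strongInduction generalizing a b with
  | H D ih =>
  by_cases hD : ∃ d ∈ D, d ∈ Set.Ioo a b
  · -- concatenate the solutions before and after a break point
    obtain ⟨d, hdD, hd⟩ := hD
    obtain ⟨B₁, hc₁, h1₁, hm₁, hv₁⟩ := ih (D.erase d) (Finset.erase_ssubset hdD) a d hd.1.le
      fun t ht htD => hX t ⟨ht.1, ht.2.trans hd.2⟩ fun h =>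
        htD (Finset.mem_erase.2 ⟨ht.2.ne, h⟩)
    obtain ⟨B₂, hc₂, h1₂, hm₂, hv₂⟩ := ih (D.erase d) (Finset.erase_ssubset hdD) d b hd.2.le
      fun t ht htD => hX t ⟨hd.1.trans ht.1, ht.2⟩ fun h =>
        htD (Finset.mem_erase.2 ⟨ht.1.ne', h⟩)
    refine ⟨fun t => if t ≤ d then B₁ t else B₂ t * B₁ d, ?_, ?_, ?_, ?_⟩
    · refine Continuous.if_le hc₁ (hc₂.mul continuous_const) continuous_id continuous_const ?_
      rintro t rfl
      rw [h1₂, one_mul]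
    · simp [hd.1.le, h1₁]
    · beta_reduce
      rw [if_neg (not_le.2 hd.2)]
      exact Subgroup.mul_mem _ hm₂ hm₁
    · intro t ht htD
      beta_reduce
      rcases lt_trichotomy t d with h | h | h
      · rw [if_pos h.le]
        refine HasMFDerivAt.congr_of_eventuallyEq
          (hv₁ t ⟨ht.1, h⟩ fun h' => htD (Finset.mem_of_mem_erase h')) ?_
        filter_upwards [Iio_mem_nhds h] with s hs
        rw [if_pos (le_of_lt hs)]
      · exact absurd (h ▸ hdD) htD
      · rw [if_neg (not_le.2 h)]
        have h1 := (hv₂ t ⟨h, ht.2⟩ fun h' => htD (Finset.mem_of_mem_erase h')).mul_const (B₁ d)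
        have h2 := rightDeriv_rightDeriv (E := E) (B₁ d) (B₂ t) 1 (X t)
        rw [one_mul] at h2
        rw [h2] at h1
        refine HasMFDerivAt.congr_of_eventuallyEq h1 ?_
        filter_upwards [Ioi_mem_nhds h] with s hs
        rw [if_neg (not_le.2 hs)]
  · -- without break points, `X` is constant
    rcases hab.eq_or_lt with rfl | hlt
    · exact ⟨fun _ => 1, continuous_const, rfl, Subgroup.one_mem _, by simp⟩
    have hconst : ∀ t ∈ Set.Ioo a b, X t = X ((a + b) / 2) := by
      intro t ht
      have hder : ∀ s ∈ Set.Ioo a b, HasDerivAt X 0 s := fun s hs =>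
        (hasDerivAt_const s (X s)).congr_of_eventuallyEq
          (hX s hs fun h => hD ⟨s, h, hs⟩)
      exact isOpen_Ioo.is_const_of_deriv_eq_zero isPreconnected_Ioo
        (fun s hs => (hder s hs).differentiableAt.differentiableWithinAt)
        (fun s hs => (hder s hs).deriv) ht ⟨by linarith, by linarith⟩
    obtain ⟨B, hB⟩ := exists_isExpCurve (G := G) (X ((a + b) / 2))
    have hcB : Continuous B := continuous_iff_continuousAt.2 fun t => (hB.2 t).continuousAt
    refine ⟨fun t => B t * (B a)⁻¹, hcB.mul continuous_const, mul_inv_cancel _,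
      Subgroup.mul_mem _ (hB.mem_expSubgroup (hXV _) b)
        (Subgroup.inv_mem _ (hB.mem_expSubgroup (hXV _) a)), fun t ht _ => ?_⟩
    have h1 := (hB.2 t).mul_const (B a)⁻¹
    have h2 := rightDeriv_rightDeriv (E := E) (B a)⁻¹ (B t) 1 (X ((a + b) / 2))
    rw [one_mul] at h2
    rw [h2, ← hconst t ht] at h1
    exact h1

end PiecewiseConstant

end AffineControl

/-! ### Trajectories -/

namespace AffineControl

section Concatenation

variable {E : Type*} [NormedAddCommGroup E] [NormedSpace ℝ E]
  {G : Type*} [TopologicalSpace G] [ChartedSpace E G]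

theorem HasVelocity.comp_sub_const {γ : ℝ → G} {v : E} {t : ℝ} (c : ℝ)
    (h : HasVelocity γ v (t - c)) : HasVelocity (fun s => γ (s - c)) v t := by
  have h1 : HasFDerivAt (fun s : ℝ => s - c) (ContinuousLinearMap.id ℝ ℝ) t :=
    (hasFDerivAt_id t).sub_const c
  have h2 : HasMFDerivAt 𝓘(ℝ, ℝ) 𝓘(ℝ, E) γ ((fun s : ℝ => s - c) t)
      ((1 : ℝ →L[ℝ] ℝ).smulRight v) := h
  exact HasMFDerivAt.comp t h2 h1.hasMFDerivAt

theorem HasVelocity.congr {γ δ : ℝ → G} {v : E} {t : ℝ} (h : HasVelocity γ v t)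
    (e : δ =ᶠ[𝓝 t] γ) : HasVelocity δ v t := by
  have h1 := HasMFDerivAt.congr_of_eventuallyEq h e
  exact h1

theorem IsPiecewiseConstant.concat {m : ℕ} {u v : ℝ → Fin m → ℝ} (hu : IsPiecewiseConstant u)
    (hv : IsPiecewiseConstant v) (c : ℝ) :
    IsPiecewiseConstant fun t => if t < c then u t else v (t - c) := by
  intro a b
  refine (((hu a b).union (Set.finite_singleton c)).union
    ((hv (a - c) (b - c)).image fun t => t + c)).subset ?_
  rintro t ⟨ht, hn⟩
  rcases lt_trichotomy t c with h | h | h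
  · refine Or.inl (Or.inl ⟨ht, fun H => hn ?_⟩)
    filter_upwards [H, Iio_mem_nhds h] with s hs hs'
    rw [if_pos h, if_pos (Set.mem_Iio.1 hs'), hs]
  · exact Or.inl (Or.inr h)
  · refine Or.inr ⟨t - c, ⟨⟨by linarith [ht.1], by linarith [ht.2]⟩, fun H => hn ?_⟩,
      sub_add_cancel t c⟩
    have H' : ∀ᶠ s in 𝓝 t, v (s - c) = v (t - c) :=
      ((continuous_sub_right c).tendsto t).eventually H
    filter_upwards [H', Ioi_mem_nhds h] with s hs hs'
    rw [if_neg (not_lt.2 h.le), if_neg (not_lt.2 (le_of_lt hs')), hs]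

/-- Controls and trajectories can be concatenated. -/
theorem reachable_trans {m : ℕ} {U : Set (Fin m → ℝ)}
    {F : (Fin m → ℝ) → (g : G) → TangentSpace 𝓘(ℝ, E) g} {g h k : G}
    (hgh : h ∈ reachable 𝓘(ℝ, E) U F g) (hhk : k ∈ reachable 𝓘(ℝ, E) U F h) :
    k ∈ reachable 𝓘(ℝ, E) U F g := by
  obtain ⟨⟨T, hT : 0 < T⟩, u, hu, γ, ⟨hγc, D, hD, hγ⟩, hγ0, hγT⟩ := Set.mem_iUnion.1 hgh
  obtain ⟨⟨S, hS : 0 < S⟩, v, hv, δ, ⟨hδc, D', hD', hδ⟩, hδ0, hδS⟩ := Set.mem_iUnion.1 hhk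
  dsimp only at hγc hγ hγT hδc hδ hδS
  have hpos {t : ℝ} (ht : T ≤ t) : (if t ≤ T then γ t else δ (t - T)) = δ (t - T) := by
    rcases ht.eq_or_lt with rfl | h
    · rw [if_pos le_rfl, sub_self, hγT, hδ0]
    · rw [if_neg (not_le.2 h)]
  refine Set.mem_iUnion.2 ⟨⟨T + S, add_pos hT hS⟩, fun t => if t < T then u t else v (t - T),
    ⟨hu.1.concat hv.1 T, fun t => ?_⟩, fun t => if t ≤ T then γ t else δ (t - T), ⟨?_,
      D ∪ {T} ∪ (fun t => t + T) '' D',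
      (hD.union (Set.finite_singleton T)).union (hD'.image _), ?_⟩, ?_, ?_⟩
  · beta_reduce
    split_ifs
    exacts [hu.2 _, hv.2 _]
  · rw [← Set.Icc_union_Icc_eq_Icc hT.le (le_add_of_nonneg_right hS.le)]
    refine ContinuousOn.union_of_isClosed ?_ ?_ isClosed_Icc isClosed_Icc
    · exact hγc.congr fun t ht => if_pos ht.2
    · refine ContinuousOn.congr (f := fun t => δ (t - T)) ?_ fun t ht => hpos ht.1
      refine hδc.comp (by fun_prop) fun t ht => ⟨sub_nonneg.2 ht.1, ?_⟩
      linarith [ht.2]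
  · rintro t ⟨ht, htD⟩
    rcases lt_trichotomy t T with h | h | h
    · have h1 : HasVelocity γ (fieldValue (F (u t)) (γ t)) t :=
        hγ t ⟨⟨ht.1, h⟩, fun h' => htD (Or.inl (Or.inl h'))⟩
      have h2 : HasVelocity (fun t => if t ≤ T then γ t else δ (t - T))
          (fieldValue (F (u t)) (γ t)) t := h1.congr (by
        filter_upwards [Iio_mem_nhds h] with s hs
        rw [if_pos (le_of_lt hs)])
      beta_reduce
      rw [if_pos h]
      rw [← show (if t ≤ T then γ t else δ (t - T)) = γ t from if_pos h.le] at h2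
      exact h2
    · exact absurd (Or.inl (Or.inr h)) htD
    · have h1 : HasVelocity δ (fieldValue (F (v (t - T))) (δ (t - T))) (t - T) := by
        refine hδ _ ⟨⟨sub_pos.2 h, ?_⟩, fun h' => htD (Or.inr ⟨_, h', sub_add_cancel t T⟩)⟩
        have := ht.2
        dsimp only at this
        linarith
      have h2 : HasVelocity (fun t => if t ≤ T then γ t else δ (t - T))
          (fieldValue (F (v (t - T))) (δ (t - T))) t := (h1.comp_sub_const T).congr (by
        filter_upwards [Ioi_mem_nhds h] with s hs
        exact hpos (le_of_lt hs))
      beta_reduce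
      rw [if_neg (not_lt.2 h.le)]
      rw [← hpos h.le] at h2
      exact h2
  · simp [hT.le, hγ0]
  · dsimp only
    rw [hpos (by linarith), add_sub_cancel_left, hδS]

end Concatenation

section Systems

variable {E : Type*} [NormedAddCommGroup E] [NormedSpace ℝ E]
  {G : Type*} [TopologicalSpace G] [ChartedSpace E G] [Group G]

/-- The element `X₀ + ∑ j, uⱼ Xⱼ` of the Lie algebra selected by the control value `u`. -/
def controlSum {m : ℕ} (X : Fin (m + 1) → E) (u : Fin m → ℝ) : E :=
  X 0 + ∑ j, u j • X j.succ

theorem fieldValue_invariantSystem {m : ℕ} (X Y : Fin (m + 1) → E) (u : Fin m → ℝ) (g : G) :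
    fieldValue (invariantSystem 𝓘(ℝ, E) (G := G) X Y u) g =
      rightDeriv g 1 (controlSum X u + controlSum Y u) := by
  have h : fieldValue (invariantSystem 𝓘(ℝ, E) (G := G) X Y u) g =
      (rightDeriv g 1 (X 0) + rightDeriv g 1 (Y 0)) +
        ∑ j : Fin m, u j • (rightDeriv g 1 (X j.succ) + rightDeriv g 1 (Y j.succ)) := rfl
  rw [h]
  simp only [controlSum, map_add, map_sum, map_smul, smul_add, Finset.sum_add_distrib]
  abel

theorem lieAd_controlSum_comm {m : ℕ} {X : Fin (m + 1) → E}
    (h : ∀ i j v, lieAd G (X i) (lieAd G (X j) v) = lieAd G (X j) (lieAd G (X i) v))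
    (u w : Fin m → ℝ) (v : E) :
    lieAd G (controlSum X u) (lieAd G (controlSum X w) v) =
      lieAd G (controlSum X w) (lieAd G (controlSum X u) v) := by
  have hs (u : Fin m → ℝ) : lieAd G (controlSum X u) =
      lieAd G (X 0) + ∑ j, u j • lieAd G (X j.succ) := by
    ext v
    rw [lieAd_swap]
    simp only [controlSum, map_add, map_sum, map_smul]
    simp [lieAd_swap v, add_comm]
  have hc (i j) : Commute (lieAd G (X i)) (lieAd G (X j)) := by
    ext v
    exact h i j v
  have hC : Commute (lieAd G (controlSum X u)) (lieAd G (controlSum X w)) := by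
    rw [hs, hs]
    refine Commute.add_left (Commute.add_right (hc _ _) (Commute.sum_right _ _ _ fun j _ => ?_))
      (Commute.sum_left _ _ _ fun i _ => Commute.add_right ?_
        (Commute.sum_right _ _ _ fun j _ => ?_))
    · exact (hc _ _).smul_right _
    · exact (hc _ _).smul_left _
    · exact ((hc _ _).smul_right _).smul_left _
  exact DFunLike.congr_fun hC v

variable [LieGroup 𝓘(ℝ, E) ∞ G]

theorem fieldValue_affineSystem [CompleteSpace E] [ConnectedSpace G] {m : ℕ}
    {𝒳 : Fin (m + 1) → (g : G) → TangentSpace 𝓘(ℝ, E) g} {X : Fin (m + 1) → E}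
    (h𝒳 : ∀ j, IsLinearField 𝓘(ℝ, E) (𝒳 j)) (hX : ∀ j, DerivationEqAd 𝓘(ℝ, E) (𝒳 j) (X j))
    (Y : Fin (m + 1) → E) (u : Fin m → ℝ) (g : G) :
    fieldValue (affineSystem 𝓘(ℝ, E) 𝒳 Y u) g =
      rightDeriv g 1 (controlSum X u + controlSum Y u) - leftDeriv g 1 (controlSum X u) := by
  have h : fieldValue (affineSystem 𝓘(ℝ, E) 𝒳 Y u) g =
      (fieldValue (𝒳 0) g + rightDeriv g 1 (Y 0)) +
        ∑ j : Fin m, u j • (fieldValue (𝒳 j.succ) g + rightDeriv g 1 (Y j.succ)) := rfl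
  rw [h]
  simp only [(h𝒳 _).fieldValue_eq (hX _), controlSum, map_add, map_sum, map_smul, smul_add,
    smul_sub, Finset.sum_add_distrib, Finset.sum_sub_distrib]
  abel

/-- The factor `B` on the right cancels the left invariant part of the velocity of `γ`. -/
theorem HasVelocity.mul_of_affine {γ B : ℝ → G} {W X : E} {t : ℝ}
    (hγ : HasVelocity γ (rightDeriv (γ t) 1 W - leftDeriv (γ t) 1 X) t)
    (hB : HasVelocity B (rightDeriv (B t) 1 X) t) :
    HasVelocity (fun s => γ s * B s) (rightDeriv (γ t * B t) 1 W) t := by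
  have h1 := rightDeriv_rightDeriv (E := E) (B t) (γ t) 1 W
  have h2 := rightDeriv_leftDeriv (E := E) (γ t) (B t) 1 X
  rw [one_mul] at h1
  rw [mul_one, one_mul] at h2
  have h := hγ.mul hB
  rw [map_sub, h1, h2, sub_add_cancel] at h
  exact h

theorem HasVelocity.mul_inv_of_rightInvariant {A B : ℝ → G} {W X : E} {t : ℝ}
    (hA : HasVelocity A (rightDeriv (A t) 1 W) t)
    (hB : HasVelocity B (rightDeriv (B t) 1 X) t) :
    HasVelocity (fun s => A s * (B s)⁻¹)
      (rightDeriv (A t * (B t)⁻¹) 1 W - leftDeriv (A t * (B t)⁻¹) 1 X) t := by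
  have h1 := rightDeriv_rightDeriv (E := E) (B t)⁻¹ (A t) 1 W
  have h2 := leftDeriv_leftDeriv (E := E) (A t) (B t)⁻¹ 1 X
  rw [one_mul] at h1
  rw [mul_one] at h2
  have h := hA.mul hB.inv_of_rightInvariant
  rw [h1, map_neg, h2, ← sub_eq_add_neg] at h
  exact h

/-- Along an admissible control, `dB/dt = X(u) B` has a solution through the identity. -/
theorem exists_solution_of_admissible [CompleteSpace E] [T2Space G] {m : ℕ}
    (X : Fin (m + 1) → E) {U : Set (Fin m → ℝ)} {u : ℝ → Fin m → ℝ} (hu : IsAdmissible U u)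
    {T : ℝ} (hT : 0 < T) :
    ∃ B : ℝ → G, Continuous B ∧ B 0 = 1 ∧ B T ∈ expSubgroup G (Set.range (controlSum X)) ∧
      ∃ D : Set ℝ, D.Finite ∧ ∀ t ∈ Set.Ioo 0 T \ D,
        HasVelocity B (rightDeriv (B t) 1 (controlSum X (u t))) t := by
  obtain ⟨B, hc, h0, hm, hv⟩ := exists_solution_of_locallyConstant (G := G)
    (V := Set.range (controlSum X)) (fun t => controlSum X (u t)) (fun t => ⟨u t, rfl⟩)
    (hu.1 0 T).toFinset 0 T hT.le (fun t ht htD => by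
      rw [Set.Finite.mem_toFinset] at htD
      have : ∀ᶠ s in 𝓝 t, u s = u t := by
        by_contra h
        exact htD ⟨⟨ht.1.le, ht.2.le⟩, h⟩
      filter_upwards [this] with s hs
      rw [hs])
  refine ⟨B, hc, h0, hm, _, hu.1 0 T, fun t ht => hv t ht.1 fun h => ht.2 ?_⟩
  rwa [Set.Finite.mem_toFinset] at h

/-- Trajectories of the affine system can be translated on the right: if `γ` is a trajectory and
`B` is the solution of `dB/dt = X(u) B` through the identity for the same control, then
`γ * (B * b * B⁻¹)` is a trajectory for each `b`. -/
theorem reachable_affineSystem_mul [CompleteSpace E] [T2Space G] [ConnectedSpace G] {m : ℕ}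
    {U : Set (Fin m → ℝ)} {𝒳 : Fin (m + 1) → (g : G) → TangentSpace 𝓘(ℝ, E) g}
    {X Y : Fin (m + 1) → E} (h𝒳 : ∀ j, IsLinearField 𝓘(ℝ, E) (𝒳 j))
    (hX : ∀ j, DerivationEqAd 𝓘(ℝ, E) (𝒳 j) (X j)) {g h : G}
    (hgh : h ∈ reachable 𝓘(ℝ, E) U (affineSystem 𝓘(ℝ, E) 𝒳 Y) g) :
    ∃ β ∈ expSubgroup G (Set.range (controlSum X)), ∀ b,
      h * (β * b * β⁻¹) ∈ reachable 𝓘(ℝ, E) U (affineSystem 𝓘(ℝ, E) 𝒳 Y) (g * b) := by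
  have : IsTopologicalGroup G := topologicalGroup_of_lieGroup 𝓘(ℝ, E) ∞
  obtain ⟨⟨T, hT : 0 < T⟩, u, hu, γ, ⟨hγc, D, hD, hγ⟩, hγ0, hγT⟩ := Set.mem_iUnion.1 hgh
  dsimp only at hγc hγ hγT
  obtain ⟨B, hBc, hB0, hBT, D', hD', hB⟩ :=
    exists_solution_of_admissible (G := G) (E := E) X hu hT
  refine ⟨B T, hBT, fun b => Set.mem_iUnion.2 ⟨⟨T, hT⟩, u, hu,
    fun t => γ t * B t * b * (B t)⁻¹, ⟨?_, D ∪ D', hD.union hD', fun t ht => ?_⟩, ?_, ?_⟩⟩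
  · exact ((hγc.mul hBc.continuousOn).mul continuousOn_const).mul hBc.continuousOn.inv
  · have h1 : HasVelocity γ (fieldValue
        (affineSystem 𝓘(ℝ, E) 𝒳 Y (u t)) (γ t)) t :=
      hγ t ⟨ht.1, fun h => ht.2 (Or.inl h)⟩
    have h2 := hB t ⟨ht.1, fun h => ht.2 (Or.inr h)⟩
    rw [fieldValue_affineSystem h𝒳 hX] at h1
    have h3 := (h1.mul_of_affine h2).mul_const b
    have h4 := rightDeriv_rightDeriv (E := E) b (γ t * B t) 1
      (controlSum X (u t) + controlSum Y (u t))
    rw [one_mul] at h4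
    rw [h4] at h3
    have h5 := h3.mul_inv_of_rightInvariant h2
    rw [← fieldValue_affineSystem h𝒳 hX] at h5
    exact h5
  · simp [hB0, hγ0]
  · simp [hγT, mul_assoc]

/-- If `A` is a trajectory of the invariant system and `B` is the solution of `dB/dt = X(u) B`
through the identity for the same control, then `A * B⁻¹` is a trajectory of the affine system. -/
theorem reachable_affineSystem_of_invariantSystem [CompleteSpace E] [T2Space G] [ConnectedSpace G] {m : ℕ}
    {U : Set (Fin m → ℝ)} {𝒳 : Fin (m + 1) → (g : G) → TangentSpace 𝓘(ℝ, E) g}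
    {X Y : Fin (m + 1) → E} (h𝒳 : ∀ j, IsLinearField 𝓘(ℝ, E) (𝒳 j))
    (hX : ∀ j, DerivationEqAd 𝓘(ℝ, E) (𝒳 j) (X j)) {g h : G}
    (hgh : h ∈ reachable 𝓘(ℝ, E) U (invariantSystem 𝓘(ℝ, E) X Y) g) :
    ∃ β ∈ expSubgroup G (Set.range (controlSum X)),
      h * β⁻¹ ∈ reachable 𝓘(ℝ, E) U (affineSystem 𝓘(ℝ, E) 𝒳 Y) g := by
  have : IsTopologicalGroup G := topologicalGroup_of_lieGroup 𝓘(ℝ, E) ∞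
  obtain ⟨⟨T, hT : 0 < T⟩, u, hu, γ, ⟨hγc, D, hD, hγ⟩, hγ0, hγT⟩ := Set.mem_iUnion.1 hgh
  dsimp only at hγc hγ hγT
  obtain ⟨B, hBc, hB0, hBT, D', hD', hB⟩ :=
    exists_solution_of_admissible (G := G) (E := E) X hu hT
  refine ⟨B T, hBT, Set.mem_iUnion.2 ⟨⟨T, hT⟩, u, hu,
    fun t => γ t * (B t)⁻¹, ⟨?_, D ∪ D', hD.union hD', fun t ht => ?_⟩, ?_, ?_⟩⟩
  · exact hγc.mul hBc.continuousOn.inv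
  · have h1 : HasVelocity γ (fieldValue
        (invariantSystem 𝓘(ℝ, E) X Y (u t)) (γ t)) t :=
      hγ t ⟨ht.1, fun h => ht.2 (Or.inl h)⟩
    have h2 := hB t ⟨ht.1, fun h => ht.2 (Or.inr h)⟩
    rw [fieldValue_invariantSystem] at h1
    have h5 := h1.mul_inv_of_rightInvariant h2
    rw [← fieldValue_affineSystem h𝒳 hX] at h5
    exact h5
  · simp [hB0, hγ0]
  · simp [hγT]

end Systems

end AffineControl

/-! ### Controllability of the affine system -/

theorem corollary3p4
    {E : Type*} [NormedAddCommGroup E] [NormedSpace ℝ E] [FiniteDimensional ℝ E]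
    {G : Type*} [TopologicalSpace G] [ChartedSpace E G] [Group G] [LieGroup 𝓘(ℝ, E) ∞ G]
    [T2Space G] [ConnectedSpace G]
    {m : ℕ} (U : Set (Fin m → ℝ))
    (𝒳 : Fin (m + 1) → (g : G) → TangentSpace 𝓘(ℝ, E) g)
    (h𝒳 : ∀ j, AffineControl.IsLinearField 𝓘(ℝ, E) (𝒳 j))
    (hcomm : ∀ i j, ∀ g : G, VectorField.mlieBracket 𝓘(ℝ, E) (𝒳 i) (𝒳 j) g = 0)
    (X Y : Fin (m + 1) → GroupLieAlgebra 𝓘(ℝ, E) G)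
    (hX : ∀ j, AffineControl.DerivationEqAd 𝓘(ℝ, E) (𝒳 j) (X j))
    (hI : AffineControl.IsControllable 𝓘(ℝ, E) U
      (AffineControl.invariantSystem 𝓘(ℝ, E) X Y))
    (he : ∃ t : ℝ, 0 < t ∧ (1 : G) ∈ interior
      (AffineControl.reachableAt 𝓘(ℝ, E) U
        (AffineControl.affineSystem 𝓘(ℝ, E) 𝒳 Y) t 1)) :
    AffineControl.IsControllable 𝓘(ℝ, E) U
      (AffineControl.affineSystem 𝓘(ℝ, E) 𝒳 Y) := by
  have : CompleteSpace E := FiniteDimensional.complete ℝ E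
  have : IsTopologicalGroup G := topologicalGroup_of_lieGroup 𝓘(ℝ, E) ∞
  have hV : ∀ v ∈ Set.range (AffineControl.controlSum (E := E) X),
      ∀ w ∈ Set.range (AffineControl.controlSum (E := E) X), ∀ z : E,
        AffineControl.lieAd G v (AffineControl.lieAd G w z) =
          AffineControl.lieAd G w (AffineControl.lieAd G v z) := by
    rintro _ ⟨u, rfl⟩ _ ⟨w, rfl⟩ z
    exact AffineControl.lieAd_controlSum_comm
      (fun i j v => (h𝒳 i).lieAd_comm (h𝒳 j) (hX i) (hX j) (hcomm i j) v) u w z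
  refine fun g => Set.eq_univ_of_forall fun h => forall_of_transitive_of_commutator
    (AffineControl.expSubgroup G (Set.range (AffineControl.controlSum (E := E) X)))
    (fun g h => h ∈ AffineControl.reachable 𝓘(ℝ, E) U
      (AffineControl.affineSystem 𝓘(ℝ, E) 𝒳 Y) g)
    AffineControl.reachable_trans
    (fun x hx y hy z hz => AffineControl.commute_commutator_of_mem_expSubgroup hV hx hy hz)
    (fun x hx => AffineControl.exists_isPreconnected_of_mem_expSubgroup hx) ?_ ?_ ?_ g h
  · intro g h hgh
    exact AffineControl.reachable_affineSystem_mul (E := E) h𝒳 hX hgh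
  · obtain ⟨t, ht, h1⟩ := he
    filter_upwards [mem_interior_iff_mem_nhds.1 h1] with x hx
    exact Set.mem_iUnion.2 ⟨⟨t, ht⟩, hx⟩
  · intro g h
    have hgh : h ∈ AffineControl.reachable 𝓘(ℝ, E) U
        (AffineControl.invariantSystem 𝓘(ℝ, E) X Y) g := hI g ▸ Set.mem_univ h
    exact AffineControl.reachable_affineSystem_of_invariantSystem (E := E) h𝒳 hX hgh
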